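/- Let $\mathcal C$ be a triangulated category that has all small coproducts (i.e. $\mathcal C$ is smashing) and satisfies Brown representability: every cohomological functor $\mathcal C^{op}\to \mathrm{Ab}$ that converts small coproducts in $\mathcal C$ into products of abelian groups is representable. Let $w=(\mathcal C_{w\le 0},\mathcal C_{w\ge 0})$ be a weight structure on $\mathcal C$, in the homological convention: both classes are closed under retracts; $\mathcal C_{w\le 0}\subset\mathcal C_{w\le 0}[1]$ and $\mathcal C_{w\ge 0}[1]\subset\mathcal C_{w\ge 0}$; every morphism from an object of $\mathcal C_{w\le 0}$ to an object of $\mathcal C_{w\ge 0}[1]$ is zero; and every object $M$ fits into a distinguished triangle $L\to M\to R\to L[1]$ with $L\in\mathcal C_{w\le 0}$ and $R\in\mathcal C_{w\ge 0}[1]$. For a $t$-structure $t=(\mathcal C_{t\le 0},\mathcal C_{t\ge 0})$ on $\mathcal C$ we also use the homological convention, so $\mathcal C_{t\ge n}=\mathcal C_{t\ge 0}[n]$, $\mathcal C_{t\le n}=\mathcal C_{t\le 0}[n]$, $\mathcal C_{t\ge 1}\subset \mathcal C_{t\ge 0}$, and every morphism from an object of $\mathcal C_{t\ge 1}$ to an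 object of $\mathcal C_{t\le 0}$ is zero. We say that $t$ is left adjacent to $w$ if every morphism from an object of $\mathcal C_{w\le 0}$ to an object of $\mathcal C_{t\ge 1}$ and every morphism from an object of $\mathcal C_{w\ge 0}$ to an object of $\mathcal C_{t\le -1}$ is zero. Then there exists a $t$-structure on $\mathcal C$ left adjacent to $w$ if and only if $w$ is smashing, i.e. $\mathcal C_{w\ge 0}$ is closed under small coproducts in $\mathcal C$. Moreover, if $t$ is a $t$-structure left adjacent to $w$, then 1. $\mathcal C_{t\ge 0}=\mathcal C_{w\ge 0}$; 2. $t$ is cosmashing, i.e. $\mathcal C$ has all small products and $\mathcal C_{t\ge 0}$ is closed under them; 3. the heart of $t$, i.e. the full subcategory of $\mathcal C$ on $\mathcal C_{t\le 0}\cap\mathcal C_{t\ge 0}$, is equivalent to the category of those additive functors $\mathrm{Hw}^{op}\to\mathrm{Ab}$ that respect small products, where $\mathrm{Hw}$, the heart of $w$, is the full subcategory of $\mathcal C$ on $\mathcal C_{w\le 0}\cap\mathcal C_{w\ge 0}$. -/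

import Mathlib

open CategoryTheory Limits

universe v u

namespace TriangulatedAdjacent

section

open Pretriangulated Triangulated
open scoped Pretriangulated.Opposite

variable (C : Type u) [Category.{v} C] [Preadditive C] [HasZeroObject C] [HasShift C ℤ]
  [∀ n : ℤ, (shiftFunctor C n).Additive] [Pretriangulated C]

/-- A weight structure on a triangulated category, in the homological convention:
`le` is the class `C_{w ≤ 0}` and `ge` is the class `C_{w ≥ 0}`. -/
structure WeightStructure where
  /-- the class `C_{w ≤ 0}` -/
  le : ObjectProperty C
  /-- the class `C_{w ≥ 0}` -/
  ge : ObjectProperty C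
  /-- `C_{w ≤ 0}` contains all retracts of its objects -/
  le_retract : le.IsStableUnderRetracts
  /-- `C_{w ≥ 0}` contains all retracts of its objects -/
  ge_retract : ge.IsStableUnderRetracts
  /-- `C_{w ≤ 0} ⊆ C_{w ≤ 0}[1]`, that is, `C_{w ≤ 0}[-1] ⊆ C_{w ≤ 0}` -/
  le_shift : ∀ X : C, le X → le (X⟦(-1 : ℤ)⟧)
  /-- `C_{w ≥ 0}[1] ⊆ C_{w ≥ 0}` -/
  ge_shift : ∀ X : C, ge X → ge (X⟦(1 : ℤ)⟧)
  /-- orthogonality: there are no nonzero morphisms from `C_{w ≤ 0}` to `C_{w ≥ 0}[1]` -/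
  orthogonal : ∀ X Y : C, le X → ge Y → ∀ f : X ⟶ Y⟦(1 : ℤ)⟧, f = 0
  /-- every object `M` has a weight decomposition `L ⟶ M ⟶ R[1] ⟶ L[1]` with `L` in `C_{w ≤ 0}`
  and `R` in `C_{w ≥ 0}` -/
  exists_decomposition : ∀ M : C, ∃ (L R : C) (_ : le L) (_ : ge R) (f : L ⟶ M)
    (g : M ⟶ R⟦(1 : ℤ)⟧) (h : R⟦(1 : ℤ)⟧ ⟶ L⟦(1 : ℤ)⟧), Triangle.mk f g h ∈ distTriang C

variable {C}

/-- The heart of a weight structure: the objects of `C_{w ≤ 0} ∩ C_{w ≥ 0}`. -/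
def WeightStructure.heart (w : WeightStructure C) : ObjectProperty C := w.le ⊓ w.ge

/-- A weight structure is smashing if `C` has all small coproducts and `C_{w ≥ 0}` is closed under
them. -/
def WeightStructure.IsSmashing (w : WeightStructure C) : Prop :=
  HasCoproducts.{v} C ∧ ∀ J : Type v, w.ge.IsClosedUnderColimitsOfShape (Discrete J)

/-- The class `C_{t ≥ n}` of a `t`-structure in the homological convention
(Mathlib's `TStructure` uses the cohomological one). -/
def tGE (t : TStructure C) (n : ℤ) : ObjectProperty C := t.le (-n)

/-- The class `C_{t ≤ n}` of a `t`-structure in the homological convention. -/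
def tLE (t : TStructure C) (n : ℤ) : ObjectProperty C := t.ge (-n)

/-- A `t`-structure is cosmashing if `C` has all small products and `C_{t ≥ 0}` is closed under
them. -/
def TIsCosmashing (t : TStructure C) : Prop :=
  HasProducts.{v} C ∧ ∀ J : Type v, (tGE t 0).IsClosedUnderLimitsOfShape (Discrete J)

/-- `w` and `t` are left adjacent: there are no nonzero morphisms from `C_{w ≤ 0}` to `C_{t ≥ 1}`,
and none from `C_{w ≥ 0}` to `C_{t ≤ -1}`. -/
def LeftAdjacent (w : WeightStructure C) (t : TStructure C) : Prop :=
  (∀ X Y : C, w.le X → tGE t 1 Y → ∀ f : X ⟶ Y, f = 0) ∧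
  (∀ X Y : C, w.ge X → tLE t (-1) Y → ∀ f : X ⟶ Y, f = 0)

variable (C) in
/-- Brown representability: every cohomological functor from `C` to abelian groups that
converts small coproducts in `C` (i.e. small products in `Cᵒᵖ`) into products is representable. -/
def BrownRepresentability : Prop :=
  ∀ H : Cᵒᵖ ⥤ AddCommGrpCat.{v}, H.IsHomological →
    (∀ J : Type v, PreservesLimitsOfShape (Discrete J) H) →
    ∃ Y : C, Nonempty (H ≅ preadditiveYoneda.obj Y)

end

/-- The additive functors `Aᵒᵖ ⥤ Ab` that respect small products. -/
def productPreservingAdditive (A : Type u) [Category.{v} A] [Preadditive A] :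
    ObjectProperty (Aᵒᵖ ⥤ AddCommGrpCat.{v}) :=
  fun F => F.Additive ∧ ∀ J : Type v, PreservesLimitsOfShape (Discrete J) F

end TriangulatedAdjacent

/-! Each of the two classes of a weight structure is the orthogonal of a shift of the other
(`le_of_orthogonal`, `ge_of_orthogonal`). For an adjacent `t`, comparing orthogonals gives `C_{t ≥
0} = C_{w ≥ 0}`. As a left orthogonal (of `C_{t ≤ -1}`) this class is closed under coproducts, so
`w` is smashing; as a right orthogonal (of `C_{w ≤ -1}`) it is closed under products. The products
themselves exist because Brown representability applies to `N ↦ ∏ Hom(N, X j)`.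

For existence, the truncation of `M` to `C_{t ≤ -1}` is constructed as a representing object. Choose
a cover `P ⟶ N`, with `P` in `C_{w ≤ 0}` and cone in `C_{w ≥ 1}`, and take `Hom(P, M)` modulo the
maps vanishing on all objects of `C_{w ≤ -1}`. Lifts between covers are unique up to maps that
vanish on `C_{w ≤ -1}`, so this is a functor of `N`. It is cohomological because the third vertex of
a triangle has a cover built as a cone (`IsLECover.of_cone`), and it converts coproducts into
products because smashing makes coproducts of covers covers. If `B` represents it, the fibre of `M ⟶
B` lies in `C_{w ≥ 0}` and `B` is right orthogonal to `C_{w ≥ 0}` (`exists_truncation`).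

For the heart, restrict the functors `Hom(-, M)` to `Hw`. An object of the heart of `t` lies in
`C_{w ≥ 0}` and receives no maps from `C_{w ≥ 1}`, so it has a two-step presentation by objects of
`Hw`, which yields full faithfulness. For essential surjectivity, a product-preserving additive `G`
on `Hw` extends to the pure functor on `C` that takes the homology of `G` on a weight complex. This
extension is again cohomological (horseshoe lemma) and product-preserving, hence representable; it
vanishes on `C_{w ≤ -1}` and `C_{w ≥ 1}`, which places the representing object in the heart. -/

namespace TriangulatedAdjacent

open Pretriangulated

/-! ### Exactness of Hom on distinguished triangles. -/

section Triangles

variable {C : Type u} [Category.{v} C] [Preadditive C] [HasZeroObject C] [HasShift C ℤ]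
  [∀ n : ℤ, (shiftFunctor C n).Additive] [Pretriangulated C]
  {X Y Z A : C} {f : X ⟶ Y} {g : Y ⟶ Z} {h : Z ⟶ X⟦(1 : ℤ)⟧}

theorem dist_comp₁₂ (hT : Triangle.mk f g h ∈ distTriang C) : f ≫ g = 0 :=
  comp_distTriang_mor_zero₁₂ _ hT

theorem dist_comp₂₃ (hT : Triangle.mk f g h ∈ distTriang C) : g ≫ h = 0 :=
  comp_distTriang_mor_zero₂₃ _ hT

theorem dist_comp₃₁ (hT : Triangle.mk f g h ∈ distTriang C) : h ≫ f⟦1⟧' = 0 :=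
  comp_distTriang_mor_zero₃₁ _ hT

theorem dist_desc₂ (hT : Triangle.mk f g h ∈ distTriang C) (a : Y ⟶ A) (ha : f ≫ a = 0) :
    ∃ b : Z ⟶ A, g ≫ b = a := by
  obtain ⟨b, hb⟩ := Triangle.yoneda_exact₂ _ hT a ha
  exact ⟨b, hb.symm⟩

theorem dist_desc₃ (hT : Triangle.mk f g h ∈ distTriang C) (a : Z ⟶ A) (ha : g ≫ a = 0) :
    ∃ b : X⟦(1 : ℤ)⟧ ⟶ A, h ≫ b = a := by
  obtain ⟨b, hb⟩ := Triangle.yoneda_exact₃ _ hT a ha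
  exact ⟨b, hb.symm⟩

theorem dist_rotate (hT : Triangle.mk f g h ∈ distTriang C) :
    Triangle.mk g h (-f⟦1⟧') ∈ distTriang C :=
  rot_of_distTriang _ hT

theorem dist_desc₁ (hT : Triangle.mk f g h ∈ distTriang C) (a : X⟦(1 : ℤ)⟧ ⟶ A)
    (ha : h ≫ a = 0) : ∃ b : Y⟦(1 : ℤ)⟧ ⟶ A, f⟦1⟧' ≫ b = a := by
  obtain ⟨b, hb⟩ := dist_desc₃ (dist_rotate hT) a ha
  exact ⟨-b, by simpa using hb⟩

theorem dist_lift₂ (hT : Triangle.mk f g h ∈ distTriang C) (a : A ⟶ Y) (ha : a ≫ g = 0) :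
    ∃ b : A ⟶ X, b ≫ f = a := by
  obtain ⟨b, hb⟩ := Triangle.coyoneda_exact₂ _ hT a ha
  exact ⟨b, hb.symm⟩

theorem dist_lift₃ (hT : Triangle.mk f g h ∈ distTriang C) (a : A ⟶ Z) (ha : a ≫ h = 0) :
    ∃ b : A ⟶ Y, b ≫ g = a := by
  obtain ⟨b, hb⟩ := Triangle.coyoneda_exact₃ _ hT a ha
  exact ⟨b, hb.symm⟩

theorem dist_lift₁ (hT : Triangle.mk f g h ∈ distTriang C) (a : A ⟶ X⟦(1 : ℤ)⟧)
    (ha : a ≫ f⟦1⟧' = 0) : ∃ b : A ⟶ Z, b ≫ h = a := by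
  obtain ⟨b, hb⟩ := Triangle.coyoneda_exact₁ _ hT a ha
  exact ⟨b, hb.symm⟩

variable {X' Y' Z' : C} {f' : X' ⟶ Y'} {g' : Y' ⟶ Z'} {h' : Z' ⟶ X'⟦(1 : ℤ)⟧}

theorem dist_map₃ (hT : Triangle.mk f g h ∈ distTriang C)
    (hT' : Triangle.mk f' g' h' ∈ distTriang C) (a : X ⟶ X') (b : Y ⟶ Y')
    (hab : f ≫ b = a ≫ f') :
    ∃ c : Z ⟶ Z', g ≫ c = b ≫ g' ∧ h ≫ a⟦1⟧' = c ≫ h' :=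
  complete_distinguished_triangle_morphism _ _ hT hT' a b hab

theorem dist_map₂ (hT : Triangle.mk f g h ∈ distTriang C)
    (hT' : Triangle.mk f' g' h' ∈ distTriang C) (a : X ⟶ X') (c : Z ⟶ Z')
    (hac : h ≫ a⟦1⟧' = c ≫ h') :
    ∃ b : Y ⟶ Y', f ≫ b = a ≫ f' ∧ g ≫ c = b ≫ g' :=
  complete_distinguished_triangle_morphism₂ _ _ hT hT' a c hac

theorem dist_of_iso (hT : Triangle.mk f g h ∈ distTriang C) (e₁ : X ≅ X') (e₂ : Y ≅ Y')
    (e₃ : Z ≅ Z') (h₁ : f ≫ e₂.hom = e₁.hom ≫ f') (h₂ : g ≫ e₃.hom = e₂.hom ≫ g')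
    (h₃ : h ≫ e₁.hom⟦1⟧' = e₃.hom ≫ h') : Triangle.mk f' g' h' ∈ distTriang C :=
  isomorphic_distinguished _ hT _ (Triangle.isoMk _ _ e₁ e₂ e₃ h₁ h₂ h₃).symm

end Triangles

/-! ### Coproducts of distinguished triangles. -/

section Coproducts

variable {C : Type u} [Category.{v} C] [Preadditive C] [HasZeroObject C] [HasShift C ℤ]
  [∀ n : ℤ, (shiftFunctor C n).Additive] [Pretriangulated C]

/-- The shift of a coproduct is a coproduct. -/
noncomputable def isColimitShiftCofan {J : Type*} {X : J → C} {c : Cofan X} (hc : IsColimit c)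
    (n : ℤ) : IsColimit (Cofan.mk (c.pt⟦n⟧) fun j => (c.inj j)⟦n⟧') :=
  Cofan.isColimitMapCoconeEquiv (shiftFunctor C n) X c (isColimitOfPreserves _ hc)

/-- The third vertex of the triangle completing a coproduct of morphisms `u j` is a coproduct of
the third vertices of triangles completing the `u j`. -/
theorem exists_isColimit_cofan_of_distinguished {J : Type*} {X Y Z : J → C}
    {u : ∀ j, X j ⟶ Y j} {v : ∀ j, Y j ⟶ Z j} {δ : ∀ j, Z j ⟶ (X j)⟦(1 : ℤ)⟧}
    (hT : ∀ j, Triangle.mk (u j) (v j) (δ j) ∈ distTriang C)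
    {cX : Cofan X} {cY : Cofan Y} (hX : IsColimit cX) (hY : IsColimit cY)
    {U : cX.pt ⟶ cY.pt} (hU : ∀ j, cX.inj j ≫ U = u j ≫ cY.inj j)
    {K : C} {V : cY.pt ⟶ K} {Δ : K ⟶ cX.pt⟦(1 : ℤ)⟧}
    (hK : Triangle.mk U V Δ ∈ distTriang C) :
    ∃ (i : ∀ j, Z j ⟶ K) (_ : IsColimit (Cofan.mk K i)), ∀ j, v j ≫ i j = cY.inj j ≫ V := by
  choose i hi₁ hi₂ using fun j => dist_map₃ (hT j) hK (cX.inj j) (cY.inj j) (hU j).symm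
  have hX' := isColimitShiftCofan hX 1
  have hY' := isColimitShiftCofan hY 1
  -- Cones are not functorial, so the universal property of `K` is checked by a five-lemma chase on
  -- `Hom(-, A)`. Here `f` factors as `Δ ≫ f'`, and `f'` turns out to factor through `U⟦1⟧'`, which
  -- `Δ` kills.
  have inj : ∀ {A : C} (f : K ⟶ A), (∀ j, i j ≫ f = 0) → f = 0 := by
    intro A f hf
    obtain ⟨f', hf'⟩ := dist_desc₃ hK f (Cofan.IsColimit.hom_ext hY _ _ fun j => by
      rw [← Category.assoc, ← hi₁, Category.assoc, hf, comp_zero, comp_zero])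
    choose g hg using fun j => dist_desc₁ (hT j) ((cX.inj j)⟦1⟧' ≫ f') (by
      rw [← Category.assoc, hi₂, Category.assoc, hf', hf])
    have hf'' : f' = U⟦1⟧' ≫ Cofan.IsColimit.desc hY' g := by
      refine Cofan.IsColimit.hom_ext hX' _ _ fun j => ?_
      have h₁ := Cofan.IsColimit.fac hY' g j
      simp only [cofan_mk_inj, Cofan.mk_pt] at h₁ ⊢
      rw [← Category.assoc, ← Functor.map_comp, hU, Functor.map_comp, Category.assoc, h₁, hg]
    rw [← hf', hf'', ← Category.assoc, dist_comp₃₁ hK, zero_comp]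
  have surj : ∀ {A : C} (f : ∀ j, Z j ⟶ A), ∃ F : K ⟶ A, ∀ j, i j ≫ F = f j := by
    intro A f
    -- `f₀` is correct only after restriction along each `v j`. The error on `Z j` therefore factors
    -- through `(X j)⟦1⟧`, and these factors glue to a correction through `Δ`.
    obtain ⟨f₀, hf₀⟩ := dist_desc₂ hK
      (Cofan.IsColimit.desc hY fun j => v j ≫ f j) (Cofan.IsColimit.hom_ext hX _ _ fun j => by
        rw [← Category.assoc, hU, Category.assoc, Cofan.IsColimit.fac, ← Category.assoc,
          dist_comp₁₂ (hT j), zero_comp, comp_zero])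
    choose h hh using fun j => dist_desc₃ (hT j) (f j - i j ≫ f₀) (by
      rw [Preadditive.comp_sub, ← Category.assoc, hi₁, Category.assoc, hf₀,
        Cofan.IsColimit.fac, sub_self])
    refine ⟨f₀ + Δ ≫ Cofan.IsColimit.desc hX' h, fun j => ?_⟩
    have h₁ := Cofan.IsColimit.fac hX' h j
    simp only [cofan_mk_inj, Cofan.mk_pt] at h₁
    rw [Preadditive.comp_add, ← Category.assoc, ← hi₂, Category.assoc, h₁, hh, add_sub_cancel]
  refine ⟨i, Cofan.IsColimit.mk _ (fun s => (surj s.inj).choose)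
    (fun s => (surj s.inj).choose_spec) fun s m hm => ?_, hi₁⟩
  rw [← sub_eq_zero]
  refine inj _ fun j => ?_
  rw [Preadditive.comp_sub, sub_eq_zero, (surj s.inj).choose_spec]
  exact hm j

/-- A coproduct of distinguished triangles is distinguished. -/
theorem exists_distinguished_of_isColimit_cofan {J : Type*} {X Y Z : J → C}
    {u : ∀ j, X j ⟶ Y j} {v : ∀ j, Y j ⟶ Z j} {δ : ∀ j, Z j ⟶ (X j)⟦(1 : ℤ)⟧}
    (hT : ∀ j, Triangle.mk (u j) (v j) (δ j) ∈ distTriang C)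
    {cX : Cofan X} {cY : Cofan Y} {cZ : Cofan Z} (hX : IsColimit cX) (hY : IsColimit cY)
    (hZ : IsColimit cZ)
    {U : cX.pt ⟶ cY.pt} (hU : ∀ j, cX.inj j ≫ U = u j ≫ cY.inj j)
    {V : cY.pt ⟶ cZ.pt} (hV : ∀ j, cY.inj j ≫ V = v j ≫ cZ.inj j) :
    ∃ Δ : cZ.pt ⟶ cX.pt⟦(1 : ℤ)⟧, Triangle.mk U V Δ ∈ distTriang C := by
  obtain ⟨K, V', Δ, hK⟩ := distinguished_cocone_triangle U
  obtain ⟨i, hi, hvi⟩ := exists_isColimit_cofan_of_distinguished hT hX hY hU hK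
  let e : K ≅ cZ.pt := hi.coconePointUniqueUpToIso hZ
  have he : ∀ j, i j ≫ e.hom = cZ.inj j := fun j =>
    hi.comp_coconePointUniqueUpToIso_hom hZ ⟨j⟩
  have hVe : V' ≫ e.hom = V := Cofan.IsColimit.hom_ext hY _ _ fun j => by
    rw [← Category.assoc, ← hvi, Category.assoc, he, hV]
  exact ⟨e.inv ≫ Δ, dist_of_iso hK (Iso.refl _) (Iso.refl _) e (by simp) (by simpa using hVe)
    (by simp)⟩

end Coproducts

end TriangulatedAdjacent

namespace TriangulatedAdjacent

open Pretriangulated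

variable {C : Type u} [Category.{v} C] [Preadditive C] [HasZeroObject C] [HasShift C ℤ]
  [∀ n : ℤ, (shiftFunctor C n).Additive] [Pretriangulated C]

set_option linter.unusedSectionVars false

section Shift

/-- The canonical isomorphism `X[a][b] ≅ X` when `a + b = 0`. -/
noncomputable abbrev shiftShiftIso (X : C) (a b : ℤ) (h : a + b = 0 := by lia) :
    (X⟦a⟧)⟦b⟧ ≅ X :=
  (shiftFunctorCompIsoId C a b h).app X

theorem shift_map_eq_zero_iff {X Y : C} (f : X ⟶ Y) (n : ℤ) : f⟦n⟧' = 0 ↔ f = 0 :=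
  (shiftFunctor C n).map_eq_zero_iff

/-- A morphism `X ⟶ Y[1]` is the shift of a morphism `X[-1] ⟶ Y`. -/
theorem exists_shift_neg_one {X Y : C} (f : X ⟶ Y⟦(1 : ℤ)⟧) :
    ∃ f' : X⟦(-1 : ℤ)⟧ ⟶ Y, f'⟦1⟧' = (shiftShiftIso X (-1) 1).hom ≫ f :=
  (shiftFunctor C (1 : ℤ)).map_surjective _

theorem dist_shift_lift {X Y Z A : C} {f : X ⟶ Y} {g : Y ⟶ Z} {h : Z ⟶ X⟦(1 : ℤ)⟧}
    (hT : Triangle.mk f g h ∈ distTriang C) (a : A ⟶ Y⟦(1 : ℤ)⟧) (ha : a ≫ g⟦1⟧' = 0) :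
    ∃ b : A ⟶ X⟦(1 : ℤ)⟧, b ≫ f⟦1⟧' = a := by
  obtain ⟨b, hb⟩ := dist_lift₂ (dist_rotate (dist_rotate (dist_rotate hT))) a (by simpa using ha)
  exact ⟨-b, by simpa using hb⟩

theorem exists_dist_shift {X Y Z : C} {f : X ⟶ Y} {g : Y ⟶ Z} {h : Z ⟶ X⟦(1 : ℤ)⟧}
    (hT : Triangle.mk f g h ∈ distTriang C) (n : ℤ) :
    ∃ (f' : X⟦n⟧ ⟶ Y⟦n⟧) (g' : Y⟦n⟧ ⟶ Z⟦n⟧) (h' : Z⟦n⟧ ⟶ (X⟦n⟧)⟦(1 : ℤ)⟧),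
      Triangle.mk f' g' h' ∈ distTriang C :=
  ⟨_, _, _, Triangle.shift_distinguished _ hT n⟩

theorem dist_of_iso₂₃ {X Y Z Y' Z' : C} {f : X ⟶ Y} {g : Y ⟶ Z} {h : Z ⟶ X⟦(1 : ℤ)⟧}
    (hT : Triangle.mk f g h ∈ distTriang C) (e₂ : Y ≅ Y') (e₃ : Z ≅ Z') :
    Triangle.mk (f ≫ e₂.hom) (e₂.inv ≫ g ≫ e₃.hom) (e₃.inv ≫ h) ∈ distTriang C :=
  dist_of_iso hT (Iso.refl _) e₂ e₃ (by simp) (by simp) (by simp)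

end Shift

/-! ### Orthogonality and closure properties of weight structures. -/

namespace WeightStructure

variable (w : WeightStructure C)

instance : w.le.IsStableUnderRetracts := w.le_retract

instance : w.ge.IsStableUnderRetracts := w.ge_retract

/-- The class `C_{w ≤ -1}`. -/
def leNeg : ObjectProperty C := fun X => w.le (X⟦(1 : ℤ)⟧)

/-- The class `C_{w ≥ 1}`. -/
def gePos : ObjectProperty C := fun X => w.ge (X⟦(-1 : ℤ)⟧)

variable {w}

theorem le_hom_gePos {X Y : C} (hX : w.le X) (hY : w.gePos Y) (f : X ⟶ Y) : f = 0 := by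
  rw [← cancel_mono (shiftShiftIso Y (-1) 1).inv, zero_comp]
  exact w.orthogonal _ _ hX hY _

theorem leNeg_hom_ge {X Y : C} (hX : w.leNeg X) (hY : w.ge Y) (f : X ⟶ Y) : f = 0 :=
  (shift_map_eq_zero_iff f 1).1 (w.orthogonal _ _ hX hY _)

theorem leNeg.le {X : C} (hX : w.leNeg X) : w.le X :=
  w.le.prop_of_iso (shiftShiftIso X 1 (-1)) (w.le_shift _ hX)

theorem gePos.ge {X : C} (hX : w.gePos X) : w.ge X :=
  w.ge.prop_of_iso (shiftShiftIso X (-1) 1) (w.ge_shift _ hX)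

theorem leNeg_shift {X : C} (hX : w.le X) : w.leNeg (X⟦(-1 : ℤ)⟧) :=
  w.le.prop_of_iso (shiftShiftIso X (-1) 1).symm hX

theorem gePos_shift {X : C} (hX : w.ge X) : w.gePos (X⟦(1 : ℤ)⟧) :=
  w.ge.prop_of_iso (shiftShiftIso X 1 (-1)).symm hX

variable (w)

theorem exists_triangle_le (M : C) : ∃ (P R : C) (_ : w.le P) (_ : w.gePos R) (f : P ⟶ M)
    (g : M ⟶ R) (h : R ⟶ P⟦(1 : ℤ)⟧), Triangle.mk f g h ∈ distTriang C := by
  obtain ⟨L, R, hL, hR, f, g, h, hT⟩ := w.exists_decomposition M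
  exact ⟨L, _, hL, gePos_shift hR, f, g, h, hT⟩

theorem exists_triangle_leNeg (M : C) : ∃ (Q V : C) (_ : w.leNeg Q) (_ : w.ge V) (f : Q ⟶ M)
    (g : M ⟶ V) (h : V ⟶ Q⟦(1 : ℤ)⟧), Triangle.mk f g h ∈ distTriang C := by
  obtain ⟨L, R, hL, hR, f, g, h, hT⟩ := w.exists_decomposition (M⟦(1 : ℤ)⟧)
  obtain ⟨f', g', h', hT'⟩ := exists_dist_shift hT (-1)
  exact ⟨_, R, leNeg_shift hL, hR, _, _, _,
    dist_of_iso₂₃ hT' (shiftShiftIso M 1 (-1)) (shiftShiftIso R 1 (-1))⟩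

variable {w}

/-- The second map of a weight decomposition of `X` vanishes, so the identity lifts to the first
vertex and `X` is a retract of it. -/
theorem le_of_orthogonal {X : C} (hX : ∀ R, w.gePos R → ∀ f : X ⟶ R, f = 0) : w.le X := by
  obtain ⟨P, R, hP, hR, f, g, h, hT⟩ := w.exists_triangle_le X
  obtain ⟨s, hs⟩ := dist_lift₂ hT (𝟙 X) (by rw [hX R hR g, comp_zero])
  exact w.le.prop_of_retract ⟨s, f, hs⟩ hP

theorem ge_of_orthogonal {Y : C} (hY : ∀ L, w.leNeg L → ∀ f : L ⟶ Y, f = 0) : w.ge Y := by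
  obtain ⟨Q, V, hQ, hV, f, g, h, hT⟩ := w.exists_triangle_leNeg Y
  obtain ⟨s, hs⟩ := dist_desc₂ hT (𝟙 Y) (by rw [hY Q hQ f, zero_comp])
  exact w.ge.prop_of_retract ⟨g, s, hs⟩ hV

theorem gePos_of_orthogonal {R : C} (hR : ∀ X, w.le X → ∀ f : X ⟶ R, f = 0) : w.gePos R := by
  refine ge_of_orthogonal fun L hL f => (shift_map_eq_zero_iff f 1).1 ?_
  rw [← cancel_mono (shiftShiftIso R (-1) 1).hom, zero_comp]
  exact hR _ hL _

theorem le_of_isZero {X : C} (hX : IsZero X) : w.le X :=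
  le_of_orthogonal fun _ _ f => hX.eq_of_src f 0

theorem ge_of_isZero {X : C} (hX : IsZero X) : w.ge X :=
  ge_of_orthogonal fun _ _ f => hX.eq_of_tgt f 0

theorem le_ext {X Y Z : C} {f : X ⟶ Y} {g : Y ⟶ Z} {h : Z ⟶ X⟦(1 : ℤ)⟧}
    (hT : Triangle.mk f g h ∈ distTriang C) (hX : w.le X) (hZ : w.le Z) : w.le Y :=
  le_of_orthogonal fun R hR a => by
    obtain ⟨b, rfl⟩ := dist_desc₂ hT a (le_hom_gePos hX hR _)
    rw [le_hom_gePos hZ hR b, comp_zero]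

theorem ge_ext {X Y Z : C} {f : X ⟶ Y} {g : Y ⟶ Z} {h : Z ⟶ X⟦(1 : ℤ)⟧}
    (hT : Triangle.mk f g h ∈ distTriang C) (hX : w.ge X) (hZ : w.ge Z) : w.ge Y :=
  ge_of_orthogonal fun L hL a => by
    obtain ⟨b, rfl⟩ := dist_lift₂ hT a (leNeg_hom_ge hL hZ _)
    rw [leNeg_hom_ge hL hX b, zero_comp]

theorem heart_biprod {X Y : C} (hX : w.heart X) (hY : w.heart Y) : w.heart (X ⊞ Y) := by
  have hT : Triangle.mk (biprod.inl : X ⟶ X ⊞ Y) biprod.snd 0 ∈ distTriang C :=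
    binaryBiproductTriangle_distinguished X Y
  exact ⟨le_ext hT hX.1 hY.1, ge_ext hT hX.2 hY.2⟩

theorem le_of_isColimit_cofan {J : Type*} {X : J → C} {c : Cofan X} (hc : IsColimit c)
    (hX : ∀ j, w.le (X j)) : w.le c.pt :=
  le_of_orthogonal fun R hR f => Cofan.IsColimit.hom_ext hc _ _ fun j => by
    rw [comp_zero, le_hom_gePos (hX j) hR (c.inj j ≫ f)]

theorem leNeg_of_isColimit_cofan {J : Type*} {X : J → C} {c : Cofan X} (hc : IsColimit c)
    (hX : ∀ j, w.leNeg (X j)) : w.leNeg c.pt :=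
  le_of_isColimit_cofan (isColimitShiftCofan hc 1) hX

theorem ge_of_isColimit_cofan (hw : w.IsSmashing) {J : Type v} {X : J → C} {c : Cofan X}
    (hc : IsColimit c) (hX : ∀ j, w.ge (X j)) : w.ge c.pt :=
  haveI := hw.2 J
  w.ge.prop_of_isColimit hc fun j => hX j.as

theorem gePos_of_isColimit_cofan (hw : w.IsSmashing) {J : Type v} {X : J → C} {c : Cofan X}
    (hc : IsColimit c) (hX : ∀ j, w.gePos (X j)) : w.gePos c.pt :=
  ge_of_isColimit_cofan hw (isColimitShiftCofan hc (-1)) hX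

theorem heart_of_isColimit_cofan (hw : w.IsSmashing) {J : Type v} {X : J → C} {c : Cofan X}
    (hc : IsColimit c) (hX : ∀ j, w.heart (X j)) : w.heart c.pt :=
  ⟨le_of_isColimit_cofan hc fun j => (hX j).1, ge_of_isColimit_cofan hw hc fun j => (hX j).2⟩

/-! ### Weight covers and their characterisation by Hom groups. -/

variable (w)

/-- A morphism `p : P ⟶ N` with `P` in `C_{w ≤ 0}` and cone in `C_{w ≥ 1}`. -/
structure IsLECover {P N : C} (p : P ⟶ N) : Prop where
  le : w.le P
  exists_triangle : ∃ (R : C) (_ : w.gePos R) (g : N ⟶ R) (h : R ⟶ P⟦(1 : ℤ)⟧),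
    Triangle.mk p g h ∈ distTriang C

/-- A morphism `j : Q ⟶ N` with `Q` in `C_{w ≤ -1}` and cone in `C_{w ≥ 0}`. -/
structure IsLENegCover {Q N : C} (j : Q ⟶ N) : Prop where
  leNeg : w.leNeg Q
  exists_triangle : ∃ (V : C) (_ : w.ge V) (g : N ⟶ V) (h : V ⟶ Q⟦(1 : ℤ)⟧),
    Triangle.mk j g h ∈ distTriang C

theorem exists_isLECover (N : C) : ∃ (P : C) (p : P ⟶ N), w.IsLECover p := by
  obtain ⟨P, R, hP, hR, f, g, h, hT⟩ := w.exists_triangle_le N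
  exact ⟨P, f, hP, R, hR, g, h, hT⟩

theorem exists_isLENegCover (N : C) : ∃ (Q : C) (j : Q ⟶ N), w.IsLENegCover j := by
  obtain ⟨P, R, hP, hR, f, g, h, hT⟩ := w.exists_triangle_leNeg N
  exact ⟨P, f, hP, R, hR, g, h, hT⟩

variable {w}

namespace IsLECover

variable {P N : C} {p : P ⟶ N}

theorem lift (hp : w.IsLECover p) {X : C} (hX : w.le X) (a : X ⟶ N) : ∃ b : X ⟶ P, b ≫ p = a := by
  obtain ⟨R, hR, g, h, hT⟩ := hp.exists_triangle
  exact dist_lift₂ hT a (le_hom_gePos hX hR _)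

theorem eq_zero_shift (hp : w.IsLECover p) {X : C} (hX : w.le X) (b : X ⟶ P⟦(1 : ℤ)⟧)
    (hb : b ≫ p⟦1⟧' = 0) : b = 0 := by
  obtain ⟨R, hR, g, h, hT⟩ := hp.exists_triangle
  obtain ⟨b', rfl⟩ := dist_lift₁ hT b hb
  rw [le_hom_gePos hX hR b', zero_comp]

theorem eq_zero (hp : w.IsLECover p) {L : C} (hL : w.leNeg L) (b : L ⟶ P) (hb : b ≫ p = 0) :
    b = 0 := by
  refine (shift_map_eq_zero_iff b 1).1 (hp.eq_zero_shift hL _ ?_)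
  rw [← Functor.map_comp, hb, Functor.map_zero]

/-- In the long exact sequence of `Hom(X, -)` with `X` in `C_{w ≤ 0}`, a map from `X` to the cone of
`p` is caught between the surjectivity `h₁` at `X` and the injectivity `h₂` at `X⟦-1⟧`, so it
vanishes. -/
theorem of_lift (hP : w.le P) (h₁ : ∀ (X : C) (_ : w.le X) (a : X ⟶ N), ∃ b : X ⟶ P, b ≫ p = a)
    (h₂ : ∀ (L : C) (_ : w.leNeg L) (b : L ⟶ P), b ≫ p = 0 → b = 0) : w.IsLECover p := by
  obtain ⟨R, g, h, hT⟩ := distinguished_cocone_triangle p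
  refine ⟨hP, R, gePos_of_orthogonal fun X hX f => ?_, g, h, hT⟩
  obtain ⟨b, hb⟩ := exists_shift_neg_one (f ≫ h)
  have hb₀ : b = 0 := h₂ _ (leNeg_shift hX) b <| (shift_map_eq_zero_iff _ 1).1 <| by
    rw [Functor.map_comp, hb, Category.assoc, Category.assoc, dist_comp₃₁ hT, comp_zero, comp_zero]
  rw [hb₀, Functor.map_zero] at hb
  obtain ⟨c, rfl⟩ := dist_lift₃ hT f (by
    rw [← cancel_epi (shiftShiftIso X (-1) 1).hom, ← hb, comp_zero])
  obtain ⟨c', rfl⟩ := h₁ X hX c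
  rw [Category.assoc, dist_comp₁₂ hT, comp_zero]

theorem id (hN : w.le N) : w.IsLECover (𝟙 N) :=
  of_lift hN (fun _ _ a => ⟨a, Category.comp_id a⟩) fun _ _ b hb => by simpa using hb

/-- Morphisms from an object to the source of a cover that are killed by the cover factor through
an object of `C_{w ≥ 0}`. -/
theorem exists_kernel (hp : w.IsLECover p) : ∃ (S : C) (_ : w.ge S) (s : S ⟶ P) (h : N ⟶ S⟦(1 : ℤ)⟧),
    Triangle.mk s p h ∈ distTriang C := by
  obtain ⟨R, hR, g, h, hT⟩ := hp.exists_triangle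
  obtain ⟨S, s, h', hT'⟩ := distinguished_cocone_triangle₁ p
  -- A map `L ⟶ S` dies in `P` by injectivity on `C_{w ≤ -1}`, so its shift comes from a map `L⟦1⟧ ⟶
  -- N`; that map lifts to `P`, so it contributes zero.
  refine ⟨S, ge_of_orthogonal fun L hL f => ?_, s, h', hT'⟩
  refine (shift_map_eq_zero_iff f 1).1 ?_
  obtain ⟨a, ha⟩ := dist_lift₃ (dist_rotate hT') (f⟦1⟧') (by
    have : f ≫ s = 0 := hp.eq_zero hL _ (by rw [Category.assoc, dist_comp₁₂ hT', comp_zero])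
    rw [Preadditive.comp_neg, ← Functor.map_comp, this, Functor.map_zero, neg_zero])
  obtain ⟨a', rfl⟩ := hp.lift hL a
  rw [← ha, Category.assoc, dist_comp₂₃ hT', comp_zero]

theorem of_isColimit_cofan (hw : w.IsSmashing) {J : Type v} {P N : J → C} {p : ∀ j, P j ⟶ N j}
    (hp : ∀ j, w.IsLECover (p j)) {cP : Cofan P} {cN : Cofan N} (hP : IsColimit cP)
    (hN : IsColimit cN) {q : cP.pt ⟶ cN.pt} (hq : ∀ j, cP.inj j ≫ q = p j ≫ cN.inj j) :
    w.IsLECover q := by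
  refine ⟨le_of_isColimit_cofan hP fun j => (hp j).le, ?_⟩
  choose R hR g h hT using fun j => (hp j).exists_triangle
  obtain ⟨K, V, Δ, hK⟩ := distinguished_cocone_triangle q
  obtain ⟨i, hi, -⟩ := exists_isColimit_cofan_of_distinguished hT hP hN hq hK
  exact ⟨K, gePos_of_isColimit_cofan hw hi hR, V, Δ, hK⟩

end IsLECover

namespace IsLENegCover

variable {Q N : C} {j : Q ⟶ N}

theorem lift (hj : w.IsLENegCover j) {L : C} (hL : w.leNeg L) (a : L ⟶ N) :
    ∃ b : L ⟶ Q, b ≫ j = a := by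
  obtain ⟨V, hV, g, h, hT⟩ := hj.exists_triangle
  exact dist_lift₂ hT a (leNeg_hom_ge hL hV _)

theorem lift_shift (hj : w.IsLENegCover j) {X : C} (hX : w.le X) (a : X ⟶ N⟦(1 : ℤ)⟧) :
    ∃ b : X ⟶ Q⟦(1 : ℤ)⟧, b ≫ j⟦1⟧' = a := by
  obtain ⟨V, hV, g, h, hT⟩ := hj.exists_triangle
  exact dist_shift_lift hT a (w.orthogonal _ _ hX hV _)

theorem eq_zero_shift (hj : w.IsLENegCover j) {L : C} (hL : w.leNeg L) (b : L ⟶ Q⟦(1 : ℤ)⟧)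
    (hb : b ≫ j⟦1⟧' = 0) : b = 0 := by
  obtain ⟨V, hV, g, h, hT⟩ := hj.exists_triangle
  obtain ⟨b', rfl⟩ := dist_lift₁ hT b hb
  rw [leNeg_hom_ge hL hV b', zero_comp]

theorem of_isColimit_cofan (hw : w.IsSmashing) {J : Type v} {Q N : J → C} {p : ∀ j, Q j ⟶ N j}
    (hp : ∀ j, w.IsLENegCover (p j)) {cQ : Cofan Q} {cN : Cofan N} (hQ : IsColimit cQ)
    (hN : IsColimit cN) {q : cQ.pt ⟶ cN.pt} (hq : ∀ j, cQ.inj j ≫ q = p j ≫ cN.inj j) :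
    w.IsLENegCover q := by
  refine ⟨leNeg_of_isColimit_cofan hQ fun j => (hp j).leNeg, ?_⟩
  choose R hR g h hT using fun j => (hp j).exists_triangle
  obtain ⟨K, V, Δ, hK⟩ := distinguished_cocone_triangle q
  obtain ⟨i, hi, -⟩ := exists_isColimit_cofan_of_distinguished hT hQ hN hq hK
  exact ⟨K, ge_of_isColimit_cofan hw hi hR, V, Δ, hK⟩

end IsLENegCover

/-- A cover of the third vertex of a distinguished triangle `X ⟶ Y ⟶ Z`, obtained as the cone of
a lift `Q ⟶ P` of `X ⟶ Y` to a cover `Q ⟶ X` by `C_{w ≤ -1}` and a cover `P ⟶ Y` by `C_{w ≤ 0}`. -/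
theorem IsLECover.of_cone {X Y Z : C} {f : X ⟶ Y} {g : Y ⟶ Z} {h : Z ⟶ X⟦(1 : ℤ)⟧}
    (hT : Triangle.mk f g h ∈ distTriang C) {Q P Z' : C} {j : Q ⟶ X} {p : P ⟶ Y}
    (hj : w.IsLENegCover j) (hp : w.IsLECover p) {a : Q ⟶ P} (ha : a ≫ p = j ≫ f)
    {i : P ⟶ Z'} {ρ : Z' ⟶ Q⟦(1 : ℤ)⟧} (hT' : Triangle.mk a i ρ ∈ distTriang C)
    {z : Z' ⟶ Z} (hz₁ : i ≫ z = p ≫ g) (hz₂ : ρ ≫ j⟦1⟧' = z ≫ h) : w.IsLECover z := by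
  -- Both conditions are four-lemma chases between the long exact sequences of the two triangles,
  -- using the lifting and injectivity ranges of `j` and `p`.
  refine of_lift (le_ext (dist_rotate hT') hp.le hj.leNeg) (fun A hA b => ?_) fun L hL b hb => ?_
  · obtain ⟨c, hc⟩ := hj.lift_shift hA (b ≫ h)
    obtain ⟨d, hd⟩ := dist_lift₁ hT' c (hp.eq_zero_shift hA _ (by
      rw [Category.assoc, ← Functor.map_comp, ha, Functor.map_comp, ← Category.assoc, hc,
        Category.assoc, dist_comp₃₁ hT, comp_zero]))
    obtain ⟨e, he⟩ := dist_lift₃ hT (b - d ≫ z) (by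
      rw [Preadditive.sub_comp, Category.assoc, ← hz₂, ← Category.assoc d, hd, hc, sub_self])
    obtain ⟨e', rfl⟩ := hp.lift hA e
    refine ⟨d + e' ≫ i, ?_⟩
    rw [Preadditive.add_comp, Category.assoc, hz₁, ← Category.assoc, he, add_sub_cancel]
  · obtain ⟨c, rfl⟩ := dist_lift₃ hT' b (hj.eq_zero_shift hL _ (by
      rw [Category.assoc, hz₂, ← Category.assoc, hb, zero_comp]))
    obtain ⟨d, hd⟩ := dist_lift₂ hT (c ≫ p) (by
      rw [Category.assoc, ← hz₁, ← Category.assoc, hb])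
    obtain ⟨d', rfl⟩ := hj.lift hL d
    have hc : c = d' ≫ a := by
      rw [← sub_eq_zero]
      refine hp.eq_zero hL _ ?_
      rw [Preadditive.sub_comp, ← hd, Category.assoc, Category.assoc, ha, sub_self]
    rw [hc, Category.assoc, dist_comp₁₂ hT', comp_zero]

end WeightStructure

end TriangulatedAdjacent

namespace TriangulatedAdjacent

/-! ### Elementwise criteria for preserving products. -/

section Products

variable {A : Type u} [Category.{v} A]

/-- A functor on the opposite category which converts coproducts into products of abelian groups,
in terms of elements. -/
theorem preservesLimitsOfShape_of_bijective (F : Aᵒᵖ ⥤ AddCommGrpCat.{v}) (J : Type v)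
    (hF : ∀ (X : J → A) (c : Cofan X) (_ : IsColimit c),
      Function.Bijective fun (x : F.obj (.op c.pt)) (j : J) => F.map (c.inj j).op x) :
    PreservesLimitsOfShape (Discrete J) F where
  preservesLimit {K} := ⟨fun {c} hc => by
    let X : J → A := fun j => (K.obj ⟨j⟩).unop
    let d : Cofan X := Cofan.mk c.pt.unop fun j => (c.π.app ⟨j⟩).unop
    have hd : IsColimit d := Cofan.IsColimit.mk _
      (fun t => (hc.lift ⟨.op t.pt, Discrete.natTrans fun j => (t.inj j.as).op⟩).unop)
      (fun t j => Quiver.Hom.op_inj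
        (hc.fac ⟨.op t.pt, Discrete.natTrans fun j => (t.inj j.as).op⟩ ⟨j⟩))
      (fun t m hm => Quiver.Hom.op_inj
        (hc.uniq ⟨.op t.pt, Discrete.natTrans fun j => (t.inj j.as).op⟩ m.op fun j =>
          Quiver.Hom.unop_inj (hm j.as)))
    refine ⟨isLimitOfReflects (forget AddCommGrpCat) (Nonempty.some ?_)⟩
    rw [Types.isLimit_iff]
    intro s _
    obtain ⟨x, hx⟩ := (hF X d hd).2 fun j => s ⟨j⟩
    exact ⟨x, fun j => congrFun hx j.as, fun y hy => (hF X d hd).1 (by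
      rw [hx]
      exact funext fun j => hy ⟨j⟩)⟩⟩

theorem bijective_of_preservesLimitsOfShape (F : Aᵒᵖ ⥤ AddCommGrpCat.{v}) {J : Type v}
    [PreservesLimitsOfShape (Discrete J) F] {X : J → A} {c : Cofan X} (hc : IsColimit c) :
    Function.Bijective fun (x : F.obj (.op c.pt)) (j : J) => F.map (c.inj j).op x := by
  have hl := isLimitOfPreserves (F ⋙ forget AddCommGrpCat) (Cofan.IsColimit.op hc)
  have h := (Types.isLimit_iff _).1 ⟨hl⟩
  refine ⟨fun x y hxy => ?_, fun s => ?_⟩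
  · obtain ⟨z, -, hz⟩ := h (fun j => F.map (c.inj j.as).op x) (by
      rintro ⟨i⟩ ⟨j⟩ ⟨⟨⟨⟩⟩⟩
      exact congrArg (fun a => a) (by simp))
    exact (hz x fun j => rfl).trans (hz y fun j => (congrFun hxy j.as).symm).symm
  · obtain ⟨z, hz, -⟩ := h (fun j => s j.as) (by
      rintro ⟨i⟩ ⟨j⟩ ⟨⟨⟨⟩⟩⟩
      exact congrArg (fun a => a) (by simp))
    exact ⟨z, funext fun j => hz ⟨j⟩⟩

end Products

/-! ### Brown representability for functors defined through choices. -/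

section Brown

open Pretriangulated

variable {C : Type u} [Category.{v} C]

/-- A contravariant functor to abelian groups whose values on objects `N` depend on auxiliary data
in `R N`, but whose action on morphisms does not involve these data. -/
structure ResolvedFunctor (R : C → Type*) where
  /-- the value on an object equipped with data -/
  obj {N : C} (D : R N) : AddCommGrpCat.{v}
  /-- the action on morphisms -/
  map {N N' : C} (D : R N) (D' : R N') (f : N ⟶ N') : obj D' ⟶ obj D
  map_id {N : C} (D : R N) : map D D (𝟙 N) = 𝟙 _
  map_comp {N N' N'' : C} (D : R N) (D' : R N') (D'' : R N'') (f : N ⟶ N') (g : N' ⟶ N'') :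
    map D D'' (f ≫ g) = map D' D'' g ≫ map D D' f

namespace ResolvedFunctor

variable {R : C → Type*} (Φ : ResolvedFunctor.{v} R)

theorem map_comp_apply {N N' N'' : C} (D : R N) (D' : R N') (D'' : R N'') (f : N ⟶ N')
    (g : N' ⟶ N'') (x : Φ.obj D'') : Φ.map D D'' (f ≫ g) x = Φ.map D D' f (Φ.map D' D'' g x) := by
  rw [Φ.map_comp D D' D'']
  rfl

theorem map_id_apply {N : C} (D : R N) (x : Φ.obj D) : Φ.map D D (𝟙 N) x = x := by
  rw [Φ.map_id]
  rfl

theorem map_id_bijective {N : C} (D D' : R N) : Function.Bijective (Φ.map D D' (𝟙 N)) :=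
  Function.bijective_iff_has_inverse.2 ⟨Φ.map D' D (𝟙 N),
    fun x => by rw [← Φ.map_comp_apply, Category.id_comp, Φ.map_id_apply],
    fun x => by rw [← Φ.map_comp_apply, Category.id_comp, Φ.map_id_apply]⟩

/-- The functor attached to a choice of data for all objects. -/
def toFunctor (s : ∀ N, R N) : Cᵒᵖ ⥤ AddCommGrpCat.{v} where
  obj N := Φ.obj (s N.unop)
  map f := Φ.map _ _ f.unop
  map_id _ := Φ.map_id _
  map_comp f g := Φ.map_comp _ _ _ g.unop f.unop

theorem bijective_transfer {J : Type*} {X : J → C} {N : C} (i : ∀ j, X j ⟶ N) (D D₁ : R N)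
    (E E₁ : ∀ j, R (X j))
    (h : Function.Bijective fun (x : Φ.obj D) (j : J) => Φ.map (E j) D (i j) x) :
    Function.Bijective fun (x : Φ.obj D₁) (j : J) => Φ.map (E₁ j) D₁ (i j) x := by
  have h₁ : (fun (x : Φ.obj D₁) (j : J) => Φ.map (E₁ j) D₁ (i j) x) =
      (fun (y : ∀ j, Φ.obj (E j)) j => Φ.map (E₁ j) (E j) (𝟙 _) (y j)) ∘
        (fun (x : Φ.obj D) (j : J) => Φ.map (E j) D (i j) x) ∘ Φ.map D D₁ (𝟙 N) := by
    funext x j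
    simp only [Function.comp_apply, ← Φ.map_comp_apply, Category.id_comp, Category.comp_id]
  rw [h₁]
  exact (Function.Bijective.piMap fun j => Φ.map_id_bijective (E₁ j) (E j)).comp
    (h.comp (Φ.map_id_bijective D D₁))

variable [Preadditive C] [HasZeroObject C] [HasShift C ℤ]
  [∀ n : ℤ, (shiftFunctor C n).Additive] [Pretriangulated C]

open scoped Pretriangulated.Opposite in
theorem isHomological_toFunctor (s : ∀ N, R N)
    (h₀ : ∀ {N N' : C} (D : R N) (D' : R N') (x : Φ.obj D'), Φ.map D D' 0 x = 0)
    (h : ∀ {X Y Z : C} {f : X ⟶ Y} {g : Y ⟶ Z} {h : Z ⟶ X⟦(1 : ℤ)⟧}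
      (_ : Triangle.mk f g h ∈ distTriang C), ∃ (DX : R X) (DY : R Y) (DZ : R Z),
      ∀ x : Φ.obj DY, Φ.map DX DY f x = 0 → ∃ y : Φ.obj DZ, Φ.map DY DZ g y = x) :
    (Φ.toFunctor s).IsHomological where
  map_zero X Y := by
    ext x
    exact h₀ _ _ x
  exact T hT := by
    rw [ShortComplex.ab_exact_iff]
    intro (x : Φ.obj (s T.obj₂.unop)) (hx : Φ.map (s T.obj₃.unop) (s _) T.mor₂.unop x = 0)
    -- Exactness is known only for data adapted to the triangle; the maps over identities are
    -- isomorphisms and carry it to the chosen data `s`.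
    obtain ⟨DX, DY, DZ, hD⟩ := h (unop_distinguished T hT)
    change ∀ x : Φ.obj DY, Φ.map DX DY T.mor₂.unop x = 0 →
      ∃ y : Φ.obj DZ, Φ.map DY DZ T.mor₁.unop y = x at hD
    obtain ⟨y, hy⟩ := hD (Φ.map DY (s _) (𝟙 _) x) (by
      rw [← Φ.map_comp_apply, Category.comp_id, ← Category.id_comp T.mor₂.unop,
        Φ.map_comp_apply _ (s _), hx, map_zero])
    refine ⟨Φ.map (s _) DZ (𝟙 _) y, ?_⟩
    change Φ.map (s _) (s _) T.mor₁.unop _ = x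
    rw [← Φ.map_comp_apply, Category.comp_id, ← Category.id_comp T.mor₁.unop,
      Φ.map_comp_apply _ DY, hy, ← Φ.map_comp_apply, Category.id_comp, Φ.map_id_apply]

/-- Brown representability for functors depending on auxiliary data. -/
theorem exists_representing [HasCoproducts.{v} C] (hC : BrownRepresentability C)
    (hs : ∀ N, Nonempty (R N))
    (h₀ : ∀ {N N' : C} (D : R N) (D' : R N') (x : Φ.obj D'), Φ.map D D' 0 x = 0)
    (h : ∀ {X Y Z : C} {f : X ⟶ Y} {g : Y ⟶ Z} {h : Z ⟶ X⟦(1 : ℤ)⟧}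
      (_ : Triangle.mk f g h ∈ distTriang C), ∃ (DX : R X) (DY : R Y) (DZ : R Z),
      ∀ x : Φ.obj DY, Φ.map DX DY f x = 0 → ∃ y : Φ.obj DZ, Φ.map DY DZ g y = x)
    (hJ : ∀ {J : Type v} {X : J → C} {c : Cofan X} (_ : IsColimit c),
      ∃ (D : R c.pt) (E : ∀ j, R (X j)),
        Function.Bijective fun (x : Φ.obj D) (j : J) => Φ.map (E j) D (c.inj j) x) :
    ∃ (Y : C) (φ : ∀ {N : C} (D : R N), Φ.obj D ≃+ (N ⟶ Y)),
      ∀ {N N' : C} (D : R N) (D' : R N') (f : N ⟶ N') (x : Φ.obj D'),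
        φ D (Φ.map D D' f x) = f ≫ φ D' x := by
  let s : ∀ N, R N := fun N => (hs N).some
  obtain ⟨Y, ⟨e⟩⟩ := hC (Φ.toFunctor s) (Φ.isHomological_toFunctor s h₀ h) fun J =>
    preservesLimitsOfShape_of_bijective _ _ fun X c hc => by
      obtain ⟨D, E, hDE⟩ := hJ hc
      exact Φ.bijective_transfer c.inj D (s _) E (fun j => s _) hDE
  let ψ : ∀ {N : C} (D : R N), Φ.obj D →+ (N ⟶ Y) := fun {N} D =>
    (e.hom.app (.op N)).hom.comp (Φ.map (s N) D (𝟙 N)).hom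
  have hψ : ∀ {N : C} (D : R N), Function.Bijective (ψ D) := fun {N} D =>
    ((ConcreteCategory.isIso_iff_bijective (e.hom.app (.op N))).1 inferInstance).comp
      (Φ.map_id_bijective (s N) D)
  refine ⟨Y, fun D => AddEquiv.ofBijective (ψ D) (hψ D), fun {N N'} D D' f x => ?_⟩
  have hn := ConcreteCategory.congr_hom (e.hom.naturality f.op) (Φ.map (s N') D' (𝟙 N') x)
  refine Eq.trans ?_ hn
  change e.hom.app (.op N) (Φ.map (s N) D (𝟙 N) (Φ.map D D' f x)) =
    e.hom.app (.op N) (Φ.map (s N) (s N') f (Φ.map (s N') D' (𝟙 N') x))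
  rw [← Φ.map_comp_apply, ← Φ.map_comp_apply, Category.comp_id, Category.id_comp]

end ResolvedFunctor

end Brown

end TriangulatedAdjacent

namespace TriangulatedAdjacent

set_option linter.unusedSectionVars false

open Pretriangulated

variable {C : Type u} [Category.{v} C] [Preadditive C] [HasZeroObject C] [HasShift C ℤ]
  [∀ n : ℤ, (shiftFunctor C n).Additive] [Pretriangulated C]

/-! ### Virtual truncations and the truncation triangles. -/

namespace WeightStructure

variable (w : WeightStructure C)

/-- The covers of an object by objects of `C_{w ≤ 0}`. -/
structure LECover (N : C) where
  /-- the source of the cover -/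
  obj : C
  /-- the cover -/
  hom : obj ⟶ N
  isLECover : w.IsLECover hom

/-- The morphisms `P ⟶ M` whose restriction to all objects of `C_{w ≤ -1}` vanishes. -/
def leNegAnnihilated (P M : C) : AddSubgroup (P ⟶ M) where
  carrier := {a | ∀ (L : C) (_ : w.leNeg L) (l : L ⟶ P), l ≫ a = 0}
  zero_mem' _ _ _ := comp_zero
  add_mem' ha hb L hL l := by rw [Preadditive.comp_add, ha L hL l, hb L hL l, add_zero]
  neg_mem' ha L hL l := by rw [Preadditive.comp_neg, ha L hL l, neg_zero]

variable {w} in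
theorem comp_mem_leNegAnnihilated {P P' M : C} {a : P' ⟶ M} (b : P ⟶ P')
    (ha : a ∈ w.leNegAnnihilated P' M) : b ≫ a ∈ w.leNegAnnihilated P M := fun L hL l => by
  rw [← Category.assoc]
  exact ha L hL _

variable {w} in
theorem IsLECover.comp_sub_comp_mem {P P' N' M : C} {p' : P' ⟶ N'} (hp' : w.IsLECover p')
    {b b' : P ⟶ P'} (h : b ≫ p' = b' ≫ p') (a : P' ⟶ M) :
    b ≫ a - b' ≫ a ∈ w.leNegAnnihilated P M := fun L hL l => by
  rw [← Preadditive.sub_comp, ← Category.assoc, hp'.eq_zero hL (l ≫ (b - b')) (by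
    rw [Category.assoc, Preadditive.sub_comp, h, sub_self, comp_zero]), zero_comp]

/-- The precomposition with `b` modulo the morphisms vanishing on `C_{w ≤ -1}`. -/
def truncComp {P P' : C} (M : C) (b : P ⟶ P') :
    ((P' ⟶ M) ⧸ w.leNegAnnihilated P' M) →+ ((P ⟶ M) ⧸ w.leNegAnnihilated P M) :=
  QuotientAddGroup.map _ _ (Preadditive.leftComp M b) fun _ ha => comp_mem_leNegAnnihilated b ha

variable {w} in
theorem IsLECover.truncComp_eq {P P' N' : C} {p' : P' ⟶ N'} (hp' : w.IsLECover p')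
    {b b' : P ⟶ P'} (h : b ≫ p' = b' ≫ p') (M : C) : w.truncComp M b = w.truncComp M b' := by
  refine AddMonoidHom.ext fun x => ?_
  obtain ⟨a, rfl⟩ := QuotientAddGroup.mk_surjective x
  exact (QuotientAddGroup.eq_iff_sub_mem).2 (hp'.comp_sub_comp_mem h a)

/-- The virtual truncation of the functor represented by `M`: its value on `N` is the quotient of
`P ⟶ M`, where `P ⟶ N` is a cover by an object of `C_{w ≤ 0}`, by the morphisms which vanish on
`C_{w ≤ -1}`. -/
noncomputable def truncFunctor (M : C) : ResolvedFunctor.{v} w.LECover where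
  obj D := AddCommGrpCat.of ((D.obj ⟶ M) ⧸ w.leNegAnnihilated D.obj M)
  map D D' f := AddCommGrpCat.ofHom (w.truncComp M
    (D'.isLECover.lift D.isLECover.le (D.hom ≫ f)).choose)
  map_id D := by
    rw [D.isLECover.truncComp_eq (b' := 𝟙 _)
      (by rw [(D.isLECover.lift D.isLECover.le (D.hom ≫ 𝟙 _)).choose_spec, Category.id_comp,
        Category.comp_id])]
    ext a
    exact congrArg QuotientAddGroup.mk (Category.id_comp a)
  map_comp D D' D'' f g := by
    rw [D''.isLECover.truncComp_eq
      (b' := (D'.isLECover.lift D.isLECover.le (D.hom ≫ f)).choose ≫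
        (D''.isLECover.lift D'.isLECover.le (D'.hom ≫ g)).choose)
      (by rw [(D''.isLECover.lift D.isLECover.le (D.hom ≫ f ≫ g)).choose_spec, Category.assoc,
        (D''.isLECover.lift D'.isLECover.le (D'.hom ≫ g)).choose_spec, ← Category.assoc,
        ← Category.assoc, (D'.isLECover.lift D.isLECover.le (D.hom ≫ f)).choose_spec])]
    ext a
    exact congrArg QuotientAddGroup.mk (Category.assoc _ _ a)

/-- The class in the virtual truncation of a morphism from a cover. -/
def truncMk {M N : C} (D : w.LECover N) : (D.obj ⟶ M) →+ (w.truncFunctor M).obj D :=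
  QuotientAddGroup.mk' _

theorem truncMk_surjective {M N : C} (D : w.LECover N) :
    Function.Surjective (w.truncMk (M := M) D) :=
  QuotientAddGroup.mk_surjective

theorem truncMk_eq_zero_iff {M N : C} (D : w.LECover N) (a : D.obj ⟶ M) :
    w.truncMk D a = 0 ↔ a ∈ w.leNegAnnihilated D.obj M :=
  QuotientAddGroup.eq_zero_iff a

theorem truncFunctor_map_mk {M N N' : C} (D : w.LECover N) (D' : w.LECover N') {f : N ⟶ N'}
    {b : D.obj ⟶ D'.obj} (hb : b ≫ D'.hom = D.hom ≫ f) (a : D'.obj ⟶ M) :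
    (w.truncFunctor M).map D D' f (w.truncMk D' a) = w.truncMk D (b ≫ a) :=
  DFunLike.congr_fun (D'.isLECover.truncComp_eq (by
    rw [hb, (D'.isLECover.lift D.isLECover.le (D.hom ≫ f)).choose_spec]) M) (w.truncMk D' a)

theorem nonempty_LECover (N : C) : Nonempty (w.LECover N) := by
  obtain ⟨P, p, hp⟩ := w.exists_isLECover N
  exact ⟨P, p, hp⟩

/-- Cover `Z` by the cone of a map `Q ⟶ DY.obj`, where `Q` is a `C_{w ≤ -1}`-cover of `X`. A class
that dies on `X` vanishes on `Q`, so it extends over that cone. -/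
theorem truncFunctor_exact (M : C) {X Y Z : C} {f : X ⟶ Y} {g : Y ⟶ Z} {h : Z ⟶ X⟦(1 : ℤ)⟧}
    (hT : Triangle.mk f g h ∈ distTriang C) :
    ∃ (DX : w.LECover X) (DY : w.LECover Y) (DZ : w.LECover Z),
      ∀ x : (w.truncFunctor M).obj DY, (w.truncFunctor M).map DX DY f x = 0 →
        ∃ y : (w.truncFunctor M).obj DZ, (w.truncFunctor M).map DY DZ g y = x := by
  obtain ⟨DX⟩ := w.nonempty_LECover X
  obtain ⟨DY⟩ := w.nonempty_LECover Y
  obtain ⟨Q, j, hj⟩ := w.exists_isLENegCover X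
  obtain ⟨j', hj'⟩ := DX.isLECover.lift hj.leNeg.le j
  obtain ⟨b, hb⟩ := DY.isLECover.lift DX.isLECover.le (DX.hom ≫ f)
  have ha : (j' ≫ b) ≫ DY.hom = j ≫ f := by rw [Category.assoc, hb, ← Category.assoc, hj']
  obtain ⟨Z', i, ρ, hT'⟩ := distinguished_cocone_triangle (j' ≫ b)
  obtain ⟨z, hz₁, hz₂⟩ := dist_map₃ hT' hT j DY.hom ha
  let DZ : w.LECover Z := ⟨Z', z, .of_cone hT hj DY.isLECover ha hT' hz₁ hz₂⟩
  refine ⟨DX, DY, DZ, fun x hx => ?_⟩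
  obtain ⟨α, rfl⟩ := w.truncMk_surjective DY x
  rw [w.truncFunctor_map_mk _ _ hb, truncMk_eq_zero_iff] at hx
  obtain ⟨β, rfl⟩ := dist_desc₂ hT' α (by rw [Category.assoc]; exact hx Q hj.leNeg j')
  exact ⟨w.truncMk DZ β, w.truncFunctor_map_mk DY DZ hz₁ β⟩

theorem truncFunctor_coproduct [HasCoproducts.{v} C] (hw : w.IsSmashing) (M : C) {J : Type v}
    {X : J → C} {c : Cofan X} (hc : IsColimit c) :
    ∃ (D : w.LECover c.pt) (E : ∀ j, w.LECover (X j)), Function.Bijective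
      fun (x : (w.truncFunctor M).obj D) (j : J) => (w.truncFunctor M).map (E j) D (c.inj j) x := by
  let E : ∀ j, w.LECover (X j) := fun j => (w.nonempty_LECover (X j)).some
  have hP := coproductIsCoproduct fun j => (E j).obj
  let q : (∐ fun j => (E j).obj) ⟶ c.pt := Sigma.desc fun j => (E j).hom ≫ c.inj j
  have hq : ∀ j, Sigma.ι (fun j => (E j).obj) j ≫ q = (E j).hom ≫ c.inj j := fun j => by simp [q]
  let D : w.LECover c.pt :=
    ⟨_, q, .of_isColimit_cofan hw (fun j => (E j).isLECover) hP hc hq⟩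
  have hmap : ∀ j a, (w.truncFunctor M).map (E j) D (c.inj j) (w.truncMk D a) =
      w.truncMk (E j) (Sigma.ι (fun j => (E j).obj) j ≫ a) := fun j a =>
    w.truncFunctor_map_mk (E j) D (hq j) a
  refine ⟨D, E, fun x y hxy => ?_, fun s => ?_⟩
  · obtain ⟨a, rfl⟩ := w.truncMk_surjective D x
    obtain ⟨b, rfl⟩ := w.truncMk_surjective D y
    rw [← sub_eq_zero, ← map_sub, truncMk_eq_zero_iff]
    have hab : ∀ j, Sigma.ι (fun j => (E j).obj) j ≫ (a - b) ∈
        w.leNegAnnihilated (E j).obj M := fun j => by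
      rw [← truncMk_eq_zero_iff, Preadditive.comp_sub, map_sub, sub_eq_zero, ← hmap, ← hmap]
      exact congrFun hxy j
    choose Q k hk using fun j => w.exists_isLENegCover (X j)
    choose k' hk' using fun j => (E j).isLECover.lift (hk j).leNeg.le (k j)
    have hkk : ∀ j, Sigma.ι Q j ≫ Sigma.desc (fun j => k j ≫ c.inj j) = k j ≫ c.inj j :=
      fun j => by simp
    have hcov := IsLENegCover.of_isColimit_cofan hw hk (coproductIsCoproduct Q) hc hkk
    intro L hL l
    obtain ⟨m, hm⟩ := hcov.lift hL (l ≫ q)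
    -- Every map from `C_{w ≤ -1}` to the coproduct of covers passes through the coproduct of the `Q
    -- j`, so vanishing there can be tested one component at a time.
    have hl : l = m ≫ Limits.Sigma.map k' := by
      rw [← sub_eq_zero]
      refine D.isLECover.eq_zero hL _ ?_
      rw [Preadditive.sub_comp, sub_eq_zero, Category.assoc]
      refine hm.symm.trans (congrArg _ (Sigma.hom_ext _ _ fun j => ?_))
      simp [D, q, ← hk']
    rw [hl, Category.assoc, show Limits.Sigma.map k' ≫ (a - b) = 0 from
      Sigma.hom_ext _ _ fun j => by
        have := hab j _ (hk j).leNeg (k' j)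
        rw [← Category.assoc, Sigma.ι_map, comp_zero, Category.assoc, this], comp_zero]
  · choose a ha using fun j => w.truncMk_surjective (E j) (s j)
    refine ⟨w.truncMk D (Sigma.desc a), funext fun j => ?_⟩
    refine (hmap j _).trans ?_
    rw [← ha, Sigma.ι_desc]

theorem truncFunctor_map_zero {M N N' : C} (D : w.LECover N) (D' : w.LECover N')
    (x : (w.truncFunctor M).obj D') : (w.truncFunctor M).map D D' 0 x = 0 := by
  obtain ⟨a, rfl⟩ := w.truncMk_surjective D' x
  rw [w.truncFunctor_map_mk (b := 0) D D' (by simp), zero_comp, map_zero]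

/-- In the presence of Brown representability, a smashing weight structure gives rise to
truncation triangles for the orthogonal `t`-structure. -/
theorem exists_truncation [HasCoproducts.{v} C] (hC : BrownRepresentability C) (hw : w.IsSmashing)
    (M : C) : ∃ (A B : C) (_ : w.ge A) (_ : ∀ N, w.ge N → ∀ f : N ⟶ B, f = 0) (f : A ⟶ M)
      (g : M ⟶ B) (h : B ⟶ A⟦(1 : ℤ)⟧), Triangle.mk f g h ∈ distTriang C := by
  obtain ⟨B, φ, hφ⟩ := (w.truncFunctor M).exists_representing hC w.nonempty_LECover
    w.truncFunctor_map_zero (w.truncFunctor_exact M) (w.truncFunctor_coproduct hw M)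
  obtain ⟨D⟩ := w.nonempty_LECover M
  -- The class of the cover itself corresponds to the transformation that sends a map to its
  -- restriction to a cover.
  let β : M ⟶ B := φ D (w.truncMk D D.hom)
  have hβ : ∀ {N : C} (E : w.LECover N) (a : N ⟶ M),
      a ≫ β = φ E (w.truncMk E (E.hom ≫ a)) := fun E a => by
    obtain ⟨b, hb⟩ := D.isLECover.lift E.isLECover.le (E.hom ≫ a)
    rw [← hφ E D, w.truncFunctor_map_mk E D hb, hb]
  obtain ⟨A, α, δ, hT⟩ := distinguished_cocone_triangle₁ β
  refine ⟨A, B, ge_of_orthogonal fun L hL f => ?_, fun N hN f => ?_, α, β, δ, hT⟩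
  -- Composition with `β` is injective on `Hom(L, M)`: the identity covers `L`, and a map
  -- annihilated on `C_{w ≤ -1}` is zero on `L` itself.
  · have hα : f ≫ α = 0 := by
      let E : w.LECover L := ⟨L, 𝟙 L, .id hL.le⟩
      have h₁ : (f ≫ α) ≫ β = 0 := by rw [Category.assoc, dist_comp₁₂ hT, comp_zero]
      rw [hβ E, map_eq_zero_iff _ (φ E).injective, truncMk_eq_zero_iff] at h₁
      simpa [E] using h₁ L hL (𝟙 L)
    refine (shift_map_eq_zero_iff f 1).1 ?_
    obtain ⟨b, hb⟩ := dist_lift₁ hT (f⟦1⟧') (by rw [← Functor.map_comp, hα, Functor.map_zero])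
    -- Composition with `β` is surjective on maps from `L⟦1⟧`, an object of `C_{w ≤ 0}` covered by
    -- its identity; hence the connecting map `δ` contributes nothing.
    let E : w.LECover (L⟦(1 : ℤ)⟧) := ⟨_, 𝟙 _, .id hL⟩
    obtain ⟨x, rfl⟩ := (φ E).surjective b
    obtain ⟨a, rfl⟩ := w.truncMk_surjective E x
    have ha := hβ E a
    rw [show E.hom ≫ a = a from Category.id_comp a] at ha
    rw [← hb, ← ha, Category.assoc, dist_comp₂₃ hT, comp_zero]
  · obtain ⟨E⟩ := w.nonempty_LECover N
    obtain ⟨x, rfl⟩ := (φ E).surjective f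
    obtain ⟨a, rfl⟩ := w.truncMk_surjective E x
    rw [map_eq_zero_iff _ (φ E).injective, truncMk_eq_zero_iff]
    intro L hL l
    rw [E.isLECover.eq_zero hL l (leNeg_hom_ge hL hN _), zero_comp]

end WeightStructure

end TriangulatedAdjacent

namespace TriangulatedAdjacent

set_option linter.unusedSectionVars false

open Pretriangulated Triangulated

variable {C : Type u} [Category.{v} C] [Preadditive C] [HasZeroObject C] [HasShift C ℤ]
  [∀ n : ℤ, (shiftFunctor C n).Additive] [Pretriangulated C]

/-! ### The adjacent `t`-structure. -/

namespace WeightStructure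

variable (w : WeightStructure C)

/-- The right orthogonal of `C_{w ≥ 0}`. -/
def geOrthogonal : ObjectProperty C := fun B => ∀ N, w.ge N → ∀ f : N ⟶ B, f = 0

instance : w.geOrthogonal.IsClosedUnderIsomorphisms where
  of_iso e h N hN f := by rw [← cancel_mono e.inv, zero_comp, h N hN (f ≫ e.inv)]

/-- The `t`-structure with `C_{t ≥ 0} = C_{w ≥ 0}`, provided that truncation triangles exist. -/
def tStructure (h : ∀ M : C, ∃ (A B : C) (_ : w.ge A) (_ : w.geOrthogonal B) (f : A ⟶ M)
    (g : M ⟶ B) (h : B ⟶ A⟦(1 : ℤ)⟧), Triangle.mk f g h ∈ distTriang C) : TStructure C where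
  le n X := w.ge (X⟦n⟧)
  -- The orthogonal of `C_{w ≥ 0}` is `C_{t ≤ -1}`, that is, cohomological degrees at least 1; hence
  -- the shift by `n - 1`.
  ge n X := w.geOrthogonal (X⟦n - 1⟧)
  le_isClosedUnderIsomorphisms n :=
    ⟨fun e hX => w.ge.prop_of_iso ((shiftFunctor C n).mapIso e) hX⟩
  ge_isClosedUnderIsomorphisms n :=
    ⟨fun e hX => w.geOrthogonal.prop_of_iso ((shiftFunctor C (n - 1)).mapIso e) hX⟩
  le_shift n a n' h X hX := w.ge.prop_of_iso ((shiftFunctorAdd' C a n' n h).app X) hX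
  ge_shift n a n' h X hX := w.geOrthogonal.prop_of_iso
    ((shiftFunctorAdd' C a (n' - 1) (n - 1) (by lia)).app X) hX
  zero' X Y f hX hY :=
    w.geOrthogonal.prop_of_iso ((shiftFunctorZero C ℤ).app Y) hY X
      (w.ge.prop_of_iso ((shiftFunctorZero C ℤ).app X) hX) f
  le_zero_le X hX := w.ge_shift _ (w.ge.prop_of_iso ((shiftFunctorZero C ℤ).app X) hX)
  ge_one_le X hX N hN f := by
    have hX' := w.geOrthogonal.prop_of_iso ((shiftFunctorZero C ℤ).app X) hX
    rw [← shift_map_eq_zero_iff f 1, ← cancel_mono (shiftShiftIso X (0 - 1) 1).hom, zero_comp]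
    exact hX' _ (w.ge_shift _ hN) _
  exists_triangle_zero_one M := by
    obtain ⟨A, B, hA, hB, f, g, h, hT⟩ := h M
    exact ⟨A, B, w.ge.prop_of_iso ((shiftFunctorZero C ℤ).symm.app A) hA,
      w.geOrthogonal.prop_of_iso ((shiftFunctorZero C ℤ).symm.app B) hB, f, g, h, hT⟩

theorem leftAdjacent_tStructure (h : ∀ M : C, ∃ (A B : C) (_ : w.ge A) (_ : w.geOrthogonal B)
    (f : A ⟶ M) (g : M ⟶ B) (h : B ⟶ A⟦(1 : ℤ)⟧), Triangle.mk f g h ∈ distTriang C) :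
    LeftAdjacent w (w.tStructure h) :=
  ⟨fun _ _ hX hY f => le_hom_gePos hX hY f, fun X Y hX hY f =>
    w.geOrthogonal.prop_of_iso ((shiftFunctorZero C ℤ).app Y) hY X hX f⟩

end WeightStructure

/-! ### Consequences of adjacency. -/

section Adjacent

variable [IsTriangulated C] {w : WeightStructure C} {t : TStructure C}

theorem tGE_zero_eq (h : LeftAdjacent w t) : tGE t 0 = w.ge := by
  ext X
  change t.le 0 X ↔ w.ge X
  refine ⟨fun hX => WeightStructure.ge_of_orthogonal fun L hL f => ?_, fun hX => ?_⟩
  · exact (shift_map_eq_zero_iff f 1).1 (h.1 _ _ hL (t.le_shift 0 1 (-1) (by lia) X hX) _)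
  · rw [t.le_iff_isLE, t.isLE_iff_orthogonal 0 1 (by lia)]
    exact fun Y f hY => h.2 X Y hX hY.ge f

theorem isLE_zero_iff (h : LeftAdjacent w t) (X : C) : t.IsLE X 0 ↔ w.ge X := by
  rw [← tGE_zero_eq h, ← t.le_iff_isLE]
  rfl

theorem isGE_zero_iff (h : LeftAdjacent w t) (X : C) :
    t.IsGE X 0 ↔ ∀ R, w.gePos R → ∀ f : R ⟶ X, f = 0 := by
  rw [t.isGE_iff_orthogonal (-1) 0 (by lia)]
  refine forall_congr' fun R => ?_
  have : t.IsLE R (-1) ↔ w.gePos R := by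
    rw [← t.isLE_shift_iff R (-1) (-1) 0, isLE_zero_iff h]
    rfl
  rw [this]
  exact forall_comm

theorem heart_iff (h : LeftAdjacent w t) (X : C) :
    t.heart X ↔ w.ge X ∧ ∀ R, w.gePos R → ∀ f : R ⟶ X, f = 0 := by
  rw [t.mem_heart_iff, isLE_zero_iff h, isGE_zero_iff h]

theorem isSmashing_of_leftAdjacent [HasCoproducts.{v} C] (h : LeftAdjacent w t) :
    w.IsSmashing := by
  refine ⟨inferInstance, fun J => ⟨fun X ⟨hX⟩ => ?_⟩⟩
  rw [← isLE_zero_iff h, t.isLE_iff_orthogonal 0 1 (by lia)]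
  exact fun Y f hY => hX.isColimit.hom_ext fun j => by
    rw [comp_zero]
    exact h.2 _ Y (hX.prop_diag_obj j) hY.ge _

theorem exists_leftAdjacent_iff [HasCoproducts.{v} C] (hC : BrownRepresentability C) :
    (∃ t : TStructure C, LeftAdjacent w t) ↔ w.IsSmashing :=
  ⟨fun ⟨_, h⟩ => isSmashing_of_leftAdjacent h, fun hw =>
    ⟨w.tStructure (w.exists_truncation hC hw), w.leftAdjacent_tStructure _⟩⟩

end Adjacent

/-! ### Existence of products and cosmashing. -/

section Cosmashing

/-- The functor sending `N` to the product of the groups of morphisms `N ⟶ X j`. -/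
def piYoneda {J : Type v} (X : J → C) : ResolvedFunctor.{v} fun _ : C => Unit where
  obj {N} _ := AddCommGrpCat.of (∀ j, N ⟶ X j)
  map _ _ f := AddCommGrpCat.ofHom (AddMonoidHom.mk' (fun x j => f ≫ x j) fun x y =>
    funext fun j => Preadditive.comp_add _ _ _ f (x j) (y j))
  map_id _ := by
    ext x j
    exact Category.id_comp (x j)
  map_comp _ _ _ f g := by
    ext x j
    exact Category.assoc f g (x j)

theorem hasProducts_of_brownRepresentability [HasCoproducts.{v} C]
    (hC : BrownRepresentability C) : HasProducts.{v} C := by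
  suffices ∀ (J : Type v) (X : J → C), HasProduct X from fun J =>
    ⟨fun K => hasLimit_of_iso (Discrete.natIsoFunctor (F := K)).symm⟩
  intro J X
  obtain ⟨Y, φ, hφ⟩ := (piYoneda X).exists_representing hC (fun _ => ⟨()⟩)
    (fun _ _ x => funext fun j => zero_comp) (fun {_ _ _ f g _} hT => ⟨(), (), (), fun x hx => by
      change ∀ j, _ at x
      choose y hy using fun j => dist_desc₂ hT (x j) (congrFun hx j)
      exact ⟨y, funext hy⟩⟩) (fun {J' X' c} hc => ⟨(), fun _ => (),
        fun x y hxy => funext fun j => Cofan.IsColimit.hom_ext hc _ _ fun i =>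
          congrFun (congrFun hxy i) j,
        fun s => ⟨fun j => Cofan.IsColimit.desc hc fun i => s i j,
          funext fun i => funext fun j => Cofan.IsColimit.fac hc (fun i => s i j) i⟩⟩)
  -- The projections form the universal element of the represented functor.
  let π : ∀ j, Y ⟶ X j := (φ ()).symm (𝟙 Y)
  have hπ : ∀ {N : C} (a : N ⟶ Y) j, a ≫ π j = (φ ()).symm a j := fun a j => by
    have h := hφ () () a π
    rw [show (φ ()) π = 𝟙 Y from (φ ()).apply_symm_apply (𝟙 Y), Category.comp_id] at h
    exact (congrFun ((AddEquiv.symm_apply_eq _).2 h.symm) j).symm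
  exact ⟨⟨Fan.mk Y π, Fan.IsLimit.mk _ (fun s => φ () s.proj)
    (fun s j => (hπ _ j).trans (congrFun ((φ ()).symm_apply_apply s.proj) j))
    fun s m hm => by
      rw [← (φ ()).apply_symm_apply m]
      exact congrArg _ (funext fun j => (hπ m j).symm.trans (hm j))⟩⟩

theorem tIsCosmashing_of_leftAdjacent [IsTriangulated C] [HasCoproducts.{v} C]
    (hC : BrownRepresentability C) {w : WeightStructure C} {t : TStructure C}
    (h : LeftAdjacent w t) : TIsCosmashing t := by
  refine ⟨hasProducts_of_brownRepresentability hC, fun J => ?_⟩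
  rw [tGE_zero_eq h]
  exact ⟨fun X ⟨hX⟩ => WeightStructure.ge_of_orthogonal fun L hL f =>
    hX.isLimit.hom_ext fun j => by
      rw [zero_comp]
      exact WeightStructure.leNeg_hom_ge hL (hX.prop_diag_obj j) _⟩

end Cosmashing

end TriangulatedAdjacent

namespace TriangulatedAdjacent

set_option linter.unusedSectionVars false

open Pretriangulated Triangulated

variable {C : Type u} [Category.{v} C] [Preadditive C] [HasZeroObject C] [HasShift C ℤ]
  [∀ n : ℤ, (shiftFunctor C n).Additive] [Pretriangulated C]

theorem dist_extend {X Y Z A : C} {f : X ⟶ Y} {g : Y ⟶ Z} {h : Z ⟶ X⟦(1 : ℤ)⟧}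
    (hT : Triangle.mk f g h ∈ distTriang C) (a : X ⟶ A) (ha : h ≫ a⟦1⟧' = 0) :
    ∃ b : Y ⟶ A, f ≫ b = a := by
  obtain ⟨b, hb⟩ := dist_desc₁ hT (a⟦1⟧') ha
  obtain ⟨b, rfl⟩ := (shiftFunctor C (1 : ℤ)).map_surjective b
  exact ⟨b, (shiftFunctor C (1 : ℤ)).map_injective (by rw [Functor.map_comp, hb])⟩

/-! ### The horseshoe lemma, resolutions and pure functors. -/

namespace WeightStructure

variable {w : WeightStructure C}

theorem IsLECover.lift_shift {P N : C} {p : P ⟶ N} (hp : w.IsLECover p) {X : C} (hX : w.le X)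
    (a : X ⟶ N⟦(1 : ℤ)⟧) : ∃ b : X ⟶ P⟦(1 : ℤ)⟧, b ≫ p⟦1⟧' = a := by
  obtain ⟨R, hR, g, h, hT⟩ := hp.exists_triangle
  exact dist_shift_lift hT a (w.orthogonal _ _ hX hR.ge _)

/-- The source of a cover of an object of `C_{w ≥ 0}` lies in the heart. -/
theorem IsLECover.heart {P N : C} {p : P ⟶ N} (hp : w.IsLECover p) (hN : w.ge N) : w.heart P := by
  obtain ⟨S, hS, s, h, hT⟩ := hp.exists_kernel
  exact ⟨hp.le, ge_ext hT hS hN⟩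

/-- The horseshoe lemma: covers of the outer vertices of a distinguished triangle extend to a
cover of the middle vertex. -/
theorem exists_horseshoe {X Y Z : C} {f : X ⟶ Y} {g : Y ⟶ Z} {h : Z ⟶ X⟦(1 : ℤ)⟧}
    (hT : Triangle.mk f g h ∈ distTriang C) {P R : C} {p : P ⟶ X} {r : R ⟶ Z}
    (hp : w.IsLECover p) (hr : w.IsLECover r) :
    ∃ (Q : C) (q : Q ⟶ Y) (_ : w.IsLECover q) (i : P ⟶ Q) (π : Q ⟶ R) (c : R ⟶ P⟦(1 : ℤ)⟧),
      Triangle.mk i π c ∈ distTriang C ∧ i ≫ q = p ≫ f ∧ π ≫ r = q ≫ g ∧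
        c ≫ p⟦1⟧' = r ≫ h := by
  -- Lifting the connecting map to the covers determines the new middle vertex; the map `q` then
  -- satisfies the cover conditions by a diagram chase.
  obtain ⟨c, hc⟩ := hp.lift_shift hr.le (r ≫ h)
  obtain ⟨Q, i, π, hT'⟩ := distinguished_cocone_triangle₂ c
  obtain ⟨q, hiq, hπ⟩ := dist_map₂ hT' hT p r hc
  refine ⟨Q, q, .of_lift (le_ext hT' hp.le hr.le) (fun A hA a => ?_) fun L hL b hb => ?_,
    i, π, c, hT', hiq, hπ, hc⟩
  · obtain ⟨a₁, ha₁⟩ := hr.lift hA (a ≫ g)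
    obtain ⟨a₂, rfl⟩ := dist_lift₃ hT' a₁ (hp.eq_zero_shift hA _ (by
      rw [Category.assoc, hc, ← Category.assoc, ha₁, Category.assoc, dist_comp₂₃ hT, comp_zero]))
    obtain ⟨e, he⟩ := dist_lift₂ hT (a - a₂ ≫ q) (by
      rw [Preadditive.sub_comp, ← ha₁, Category.assoc, Category.assoc, hπ, sub_self])
    obtain ⟨e', rfl⟩ := hp.lift hA e
    exact ⟨a₂ + e' ≫ i, by
      rw [Preadditive.add_comp, Category.assoc e', hiq, ← Category.assoc, he, add_sub_cancel]⟩
  · obtain ⟨b', rfl⟩ := dist_lift₂ hT' b (hr.eq_zero hL _ (by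
      rw [Category.assoc, hπ, ← Category.assoc, hb, zero_comp]))
    obtain ⟨m, hm⟩ := dist_lift₁ hT ((b' ≫ p)⟦1⟧') (by
      rw [← Functor.map_comp, Category.assoc, ← hiq, ← Category.assoc, hb, Functor.map_zero])
    obtain ⟨m', rfl⟩ := hr.lift hL m
    have hb' : m' ≫ c = b'⟦1⟧' := by
      rw [← sub_eq_zero]
      refine hp.eq_zero_shift hL _ ?_
      rw [Preadditive.sub_comp, Category.assoc, hc, ← Category.assoc, hm, Functor.map_comp,
        sub_self]
    rw [← shift_map_eq_zero_iff _ 1, Functor.map_comp, ← hb', Category.assoc, dist_comp₃₁ hT',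
      comp_zero]

variable (w)

/-- A morphism `q : P ⟶ H` to an object of the heart through which all morphisms from `P` to
objects of `C_{w ≥ 0}` factor. -/
def IsGEEnvelope {P H : C} (q : P ⟶ H) : Prop :=
  ∀ (V : C) (_ : w.ge V) (a : P ⟶ V), ∃ b : H ⟶ V, q ≫ b = a

/-- The beginning of a weight complex of `N`: a cover `P ⟶ N` by an object of `C_{w ≤ 0}` and an
envelope of `P` by an object of the heart. -/
structure Resolution (N : C) where
  /-- the source of the cover -/
  obj : C
  /-- the cover -/
  hom : obj ⟶ N
  isLECover : w.IsLECover hom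
  /-- the target of the envelope -/
  core : w.heart.FullSubcategory
  /-- the envelope -/
  env : obj ⟶ core.obj
  isGEEnvelope : w.IsGEEnvelope env

theorem nonempty_resolution (N : C) : Nonempty (w.Resolution N) := by
  obtain ⟨P, p, hp⟩ := w.exists_isLECover N
  obtain ⟨Q, V, hQ, hV, j, q, h, hT⟩ := w.exists_triangle_leNeg P
  -- `V` is an extension of `Q⟦1⟧` by `P`, both in `C_{w ≤ 0}`, so it lies in the heart.
  exact ⟨⟨P, p, hp, ⟨V, le_ext (dist_rotate hT) hp.le hQ, hV⟩, q, fun V' hV' a =>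
    dist_desc₂ hT a (leNeg_hom_ge hQ hV' _)⟩⟩

section PureFunctor

variable {w} (G : w.heart.FullSubcategoryᵒᵖ ⥤ AddCommGrpCat.{v})

/-- The action of a morphism of the heart on a contravariant functor. -/
def heartRes {H H' : w.heart.FullSubcategory} (d : H.obj ⟶ H'.obj) :
    G.obj (.op H') →+ G.obj (.op H) :=
  (G.map (ObjectProperty.homMk d).op).hom

theorem heartRes_id (H : w.heart.FullSubcategory) (x : G.obj (.op H)) :
    heartRes G (𝟙 H.obj) x = x :=
  ConcreteCategory.congr_hom (G.map_id (.op H)) x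

theorem heartRes_comp {H H' H'' : w.heart.FullSubcategory} (d : H.obj ⟶ H'.obj)
    (d' : H'.obj ⟶ H''.obj) (x : G.obj (.op H'')) :
    heartRes G (d ≫ d') x = heartRes G d (heartRes G d' x) :=
  ConcreteCategory.congr_hom
    (G.map_comp (ObjectProperty.homMk d').op (ObjectProperty.homMk d).op) x

variable [G.Additive]

theorem heartRes_add {H H' : w.heart.FullSubcategory} (d d' : H.obj ⟶ H'.obj)
    (x : G.obj (.op H')) : heartRes G (d + d') x = heartRes G d x + heartRes G d' x :=
  ConcreteCategory.congr_hom (G.map_add (f := (ObjectProperty.homMk d).op)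
    (g := (ObjectProperty.homMk d').op)) x

/-- The additivity of `heartRes` in the morphism. -/
def heartResHom {H H' : w.heart.FullSubcategory} (x : G.obj (.op H')) :
    (H.obj ⟶ H'.obj) →+ G.obj (.op H) :=
  AddMonoidHom.mk' (fun d => heartRes G d x) fun d d' => heartRes_add G d d' x

theorem heartRes_zero {H H' : w.heart.FullSubcategory} (x : G.obj (.op H')) :
    heartRes G (0 : H.obj ⟶ H'.obj) x = 0 :=
  map_zero (heartResHom G x)

theorem heartRes_sub {H H' : w.heart.FullSubcategory} (d d' : H.obj ⟶ H'.obj)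
    (x : G.obj (.op H')) : heartRes G (d - d') x = heartRes G d x - heartRes G d' x :=
  map_sub (heartResHom G x) d d'

/-- The sections over the core of a resolution which vanish on all objects of the heart that map
to zero in the resolved object. -/
def cycles {N : C} (D : w.Resolution N) : AddSubgroup (G.obj (.op D.core)) where
  carrier := {x | ∀ (K : w.heart.FullSubcategory) (k : K.obj ⟶ D.obj), k ≫ D.hom = 0 →
    heartRes G (k ≫ D.env) x = 0}
  zero_mem' _ _ _ := map_zero _
  add_mem' hx hy K k hk := by rw [map_add, hx K k hk, hy K k hk, add_zero]
  neg_mem' hx K k hk := by rw [map_neg, hx K k hk, neg_zero]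

/-- The sections over the core of a resolution which come from a morphism of the heart that
vanishes on the cover. -/
def boundaries {N : C} (D : w.Resolution N) : AddSubgroup (G.obj (.op D.core)) where
  carrier := {x | ∃ (H : w.heart.FullSubcategory) (d : D.core.obj ⟶ H.obj) (y : G.obj (.op H)),
    D.env ≫ d = 0 ∧ heartRes G d y = x}
  zero_mem' := ⟨D.core, 0, 0, comp_zero, map_zero _⟩
  add_mem' := by
    rintro _ _ ⟨H, d, y, hd, rfl⟩ ⟨H', d', y', hd', rfl⟩
    let H'' : w.heart.FullSubcategory := ⟨H.obj ⊞ H'.obj, heart_biprod H.property H'.property⟩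
    let d'' : D.core.obj ⟶ H''.obj := biprod.lift d d'
    refine ⟨H'', d'', heartRes G (H := H'') biprod.fst y + heartRes G (H := H'') biprod.snd y',
      ?_, ?_⟩
    · exact biprod.hom_ext _ _ (by simp [d'', hd]) (by simp [d'', hd'])
    · rw [map_add, ← heartRes_comp, ← heartRes_comp, biprod.lift_fst, biprod.lift_snd]
  neg_mem' := by
    rintro _ ⟨H, d, y, hd, rfl⟩
    exact ⟨H, d, -y, hd, map_neg _ _⟩

theorem boundaries_le_cycles {N : C} (D : w.Resolution N) : boundaries G D ≤ cycles G D := by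
  rintro _ ⟨H, d, y, hd, rfl⟩ K k -
  rw [← heartRes_comp, Category.assoc, hd, comp_zero, heartRes_zero]

theorem heartRes_mem_cycles {N N' : C} {D : w.Resolution N} {D' : w.Resolution N'} {f : N ⟶ N'}
    {a : D.obj ⟶ D'.obj} {b : D.core.obj ⟶ D'.core.obj} (ha : a ≫ D'.hom = D.hom ≫ f)
    (hb : D.env ≫ b = a ≫ D'.env) {x : G.obj (.op D'.core)} (hx : x ∈ cycles G D') :
    heartRes G b x ∈ cycles G D := fun K k hk => by
  rw [← heartRes_comp, Category.assoc, hb, ← Category.assoc]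
  exact hx K _ (by rw [Category.assoc, ha, ← Category.assoc, hk, zero_comp])

theorem heartRes_mem_boundaries {N N' : C} {D : w.Resolution N} {D' : w.Resolution N'}
    {a : D.obj ⟶ D'.obj} {b : D.core.obj ⟶ D'.core.obj}
    (hb : D.env ≫ b = a ≫ D'.env) {x : G.obj (.op D'.core)} (hx : x ∈ boundaries G D') :
    heartRes G b x ∈ boundaries G D := by
  obtain ⟨H, d, y, hd, rfl⟩ := hx
  exact ⟨H, b ≫ d, y, by rw [← Category.assoc, hb, Category.assoc, hd, comp_zero],
    heartRes_comp G _ _ _⟩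

/-- This is the chain homotopy argument: two lifts of one map differ by a map through the fibre `S`
of the cover, which lies in `C_{w ≥ 0}`, so the difference extends to the core of `D`. -/
theorem heartRes_sub_mem_boundaries {N N' : C} {D : w.Resolution N} {D' : w.Resolution N'}
    {a a' : D.obj ⟶ D'.obj} {b b' : D.core.obj ⟶ D'.core.obj} (h : a ≫ D'.hom = a' ≫ D'.hom)
    (hb : D.env ≫ b = a ≫ D'.env) (hb' : D.env ≫ b' = a' ≫ D'.env) {x : G.obj (.op D'.core)}
    (hx : x ∈ cycles G D') : heartRes G b x - heartRes G b' x ∈ boundaries G D := by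
  obtain ⟨S, hS, s, _, hT⟩ := D'.isLECover.exists_kernel
  obtain ⟨c, hc⟩ := dist_lift₂ hT (a - a') (by rw [Preadditive.sub_comp, h, sub_self])
  obtain ⟨c', rfl⟩ := D.isGEEnvelope S hS c
  -- With the homotopy term subtracted, the morphism vanishes on the envelope; that term acts by
  -- zero on `x` because `x` is a cycle.
  refine ⟨D'.core, b - b' - (c' ≫ s) ≫ D'.env, x, ?_, ?_⟩
  · rw [Preadditive.comp_sub, Preadditive.comp_sub, hb, hb', ← Preadditive.sub_comp, ← hc,
      Category.assoc, Category.assoc, Category.assoc, sub_self]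
  · rw [heartRes_sub, heartRes_sub, hx D.core (c' ≫ s)
      (by rw [Category.assoc, dist_comp₁₂ hT, comp_zero]), sub_zero]

theorem Resolution.exists_lift {N N' : C} (D : w.Resolution N) (D' : w.Resolution N') (f : N ⟶ N') :
    ∃ (ab : (D.obj ⟶ D'.obj) × (D.core.obj ⟶ D'.core.obj)),
      ab.1 ≫ D'.hom = D.hom ≫ f ∧ D.env ≫ ab.2 = ab.1 ≫ D'.env := by
  obtain ⟨a, ha⟩ := D'.isLECover.lift D.isLECover.le (D.hom ≫ f)
  obtain ⟨b, hb⟩ := D.isGEEnvelope _ D'.core.property.2 (a ≫ D'.env)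
  exact ⟨(a, b), ha, hb⟩

/-- The homology of the beginning of a weight complex with values in `G`. -/
abbrev PureHomology {N : C} (D : w.Resolution N) : Type v :=
  cycles G D ⧸ (boundaries G D).addSubgroupOf (cycles G D)

/-- The morphism induced on homology by a morphism of resolutions. -/
def pureMap {N N' : C} {D : w.Resolution N} {D' : w.Resolution N'} {f : N ⟶ N'}
    {a : D.obj ⟶ D'.obj} {b : D.core.obj ⟶ D'.core.obj} (ha : a ≫ D'.hom = D.hom ≫ f)
    (hb : D.env ≫ b = a ≫ D'.env) : PureHomology G D' →+ PureHomology G D :=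
  QuotientAddGroup.map _ _
    (((heartRes G b).comp (cycles G D').subtype).codRestrict (cycles G D)
      fun x => heartRes_mem_cycles G ha hb x.2)
    fun _ hx => heartRes_mem_boundaries G hb hx

theorem pureMap_eq {N N' : C} {D : w.Resolution N} {D' : w.Resolution N'} {f f' : N ⟶ N'}
    {a a' : D.obj ⟶ D'.obj} {b b' : D.core.obj ⟶ D'.core.obj} (ha : a ≫ D'.hom = D.hom ≫ f)
    (hb : D.env ≫ b = a ≫ D'.env) (ha' : a' ≫ D'.hom = D.hom ≫ f')
    (hb' : D.env ≫ b' = a' ≫ D'.env) (hf : f = f') : pureMap G ha hb = pureMap G ha' hb' := by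
  refine AddMonoidHom.ext fun x => ?_
  obtain ⟨x, rfl⟩ := QuotientAddGroup.mk_surjective x
  exact (QuotientAddGroup.eq_iff_sub_mem).2
    (heartRes_sub_mem_boundaries G (by rw [ha, ha', hf]) hb hb' x.2)

/-- The pure functor attached to an additive functor on the heart. -/
noncomputable def pureFunctor : ResolvedFunctor.{v} w.Resolution where
  obj D := AddCommGrpCat.of (PureHomology G D)
  map D D' f := AddCommGrpCat.ofHom (pureMap G (D.exists_lift D' f).choose_spec.1
    (D.exists_lift D' f).choose_spec.2)
  map_id D := by
    rw [pureMap_eq G (a' := 𝟙 _) (b' := 𝟙 _) _ _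
      (by rw [Category.id_comp, Category.comp_id]) (by rw [Category.id_comp, Category.comp_id]) rfl]
    ext x
    exact congrArg QuotientAddGroup.mk (Subtype.ext (heartRes_id G _ _))
  map_comp D D' D'' f g := by
    have h₁ := (D.exists_lift D' f).choose_spec
    have h₂ := (D'.exists_lift D'' g).choose_spec
    rw [pureMap_eq G (a' := (D.exists_lift D' f).choose.1 ≫ (D'.exists_lift D'' g).choose.1)
      (b' := (D.exists_lift D' f).choose.2 ≫ (D'.exists_lift D'' g).choose.2) _ _
      (by rw [Category.assoc, h₂.1, ← Category.assoc, h₁.1, Category.assoc])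
      (by rw [← Category.assoc, h₁.2, Category.assoc, h₂.2, Category.assoc]) rfl]
    ext x
    exact congrArg QuotientAddGroup.mk (Subtype.ext (heartRes_comp G _ _ _))

/-- The class of a cycle. -/
def pureMk {N : C} (D : w.Resolution N) (x : G.obj (.op D.core)) (hx : x ∈ cycles G D) :
    (pureFunctor G).obj D :=
  QuotientAddGroup.mk (s := (boundaries G D).addSubgroupOf (cycles G D)) ⟨x, hx⟩

theorem exists_pureMk {N : C} (D : w.Resolution N) (y : (pureFunctor G).obj D) :
    ∃ (x : G.obj (.op D.core)) (hx : x ∈ cycles G D), pureMk G D x hx = y := by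
  obtain ⟨x, rfl⟩ := QuotientAddGroup.mk_surjective
    (s := (boundaries G D).addSubgroupOf (cycles G D)) y
  exact ⟨x.1, x.2, rfl⟩

theorem pureMk_eq_iff {N : C} (D : w.Resolution N) {x y : G.obj (.op D.core)}
    (hx : x ∈ cycles G D) (hy : y ∈ cycles G D) :
    pureMk G D x hx = pureMk G D y hy ↔ x - y ∈ boundaries G D :=
  QuotientAddGroup.eq_iff_sub_mem

theorem pureMk_eq_zero_iff {N : C} (D : w.Resolution N) {x : G.obj (.op D.core)}
    (hx : x ∈ cycles G D) : pureMk G D x hx = 0 ↔ x ∈ boundaries G D :=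
  QuotientAddGroup.eq_zero_iff _

theorem pureFunctor_map_mk {N N' : C} (D : w.Resolution N) (D' : w.Resolution N') {f : N ⟶ N'}
    {a : D.obj ⟶ D'.obj} {b : D.core.obj ⟶ D'.core.obj} (ha : a ≫ D'.hom = D.hom ≫ f)
    (hb : D.env ≫ b = a ≫ D'.env) {x : G.obj (.op D'.core)} (hx : x ∈ cycles G D') :
    (pureFunctor G).map D D' f (pureMk G D' x hx) =
      pureMk G D (heartRes G b x) (heartRes_mem_cycles G ha hb hx) :=
  DFunLike.congr_fun (pureMap_eq G (D.exists_lift D' f).choose_spec.1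
    (D.exists_lift D' f).choose_spec.2 ha hb rfl) (pureMk G D' x hx)

theorem pureFunctor_map_zero {N N' : C} (D : w.Resolution N) (D' : w.Resolution N')
    (x : (pureFunctor G).obj D') : (pureFunctor G).map D D' 0 x = 0 := by
  obtain ⟨x, hx, rfl⟩ := exists_pureMk G D' x
  rw [pureFunctor_map_mk G D D' (a := 0) (b := 0) (by simp) (by simp), pureMk_eq_zero_iff,
    heartRes_zero]
  exact zero_mem _

end PureFunctor

end WeightStructure

end TriangulatedAdjacent

namespace TriangulatedAdjacent

set_option linter.unusedSectionVars false

open Pretriangulated Triangulated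

variable {C : Type u} [Category.{v} C] [Preadditive C] [HasZeroObject C] [HasShift C ℤ]
  [∀ n : ℤ, (shiftFunctor C n).Additive] [Pretriangulated C]

namespace WeightStructure

/-! ### Pure functors are cohomological and convert coproducts into products. -/

section PureFunctor

variable {w : WeightStructure C} (G : w.heart.FullSubcategoryᵒᵖ ⥤ AddCommGrpCat.{v}) [G.Additive]

theorem pureFunctor_exact {X Y Z : C} {f : X ⟶ Y} {g : Y ⟶ Z} {h : Z ⟶ X⟦(1 : ℤ)⟧}
    (hT : Triangle.mk f g h ∈ distTriang C) :
    ∃ (DX : w.Resolution X) (DY : w.Resolution Y) (DZ : w.Resolution Z),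
      ∀ x : (pureFunctor G).obj DY, (pureFunctor G).map DX DY f x = 0 →
        ∃ y : (pureFunctor G).obj DZ, (pureFunctor G).map DY DZ g y = x := by
  obtain ⟨DX⟩ := w.nonempty_resolution X
  obtain ⟨DZ⟩ := w.nonempty_resolution Z
  obtain ⟨Q, q, hq, i, π, c, hT', hi, hπ, hc⟩ := exists_horseshoe hT DX.isLECover DZ.isLECover
  -- The obstruction is a map from `C_{w ≤ 0}` to `C_{w ≥ 0}[1]`, so it vanishes; `Y` therefore has
  -- a resolution whose core is the sum of the outer cores.
  obtain ⟨e, he⟩ := dist_extend hT' DX.env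
    (w.orthogonal _ _ DZ.isLECover.le DX.core.property.2 _)
  let H : w.heart.FullSubcategory :=
    ⟨DX.core.obj ⊞ DZ.core.obj, heart_biprod DX.core.property DZ.core.property⟩
  let ι₁ : DX.core.obj ⟶ H.obj := biprod.inl
  let ι₂ : DZ.core.obj ⟶ H.obj := biprod.inr
  let π₂ : H.obj ⟶ DZ.core.obj := biprod.snd
  let DY : w.Resolution Y := ⟨Q, q, hq, H, biprod.lift e (π ≫ DZ.env), fun V hV a => by
    obtain ⟨a₁, ha₁⟩ := DX.isGEEnvelope V hV (i ≫ a)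
    obtain ⟨a₂, ha₂⟩ := dist_desc₂ hT' (a - e ≫ a₁) (by
      rw [Preadditive.comp_sub, ← Category.assoc i e, he, ha₁, sub_self])
    obtain ⟨a₃, rfl⟩ := DZ.isGEEnvelope V hV a₂
    exact ⟨biprod.desc a₁ a₃, by rw [biprod.lift_desc, Category.assoc, ha₂, add_sub_cancel]⟩⟩
  have hι₁ : DX.env ≫ ι₁ = i ≫ DY.env := biprod.hom_ext _ _ (by simp [ι₁, DY, he])
    (by
      simp only [ι₁, DY, Category.assoc, biprod.inl_snd, comp_zero, biprod.lift_snd]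
      rw [← Category.assoc, dist_comp₁₂ hT', zero_comp])
  have hπ₂ : DY.env ≫ π₂ = π ≫ DZ.env := biprod.lift_snd _ _
  refine ⟨DX, DY, DZ, fun x hx => ?_⟩
  obtain ⟨x, hx', rfl⟩ := exists_pureMk G DY x
  rw [pureFunctor_map_mk G DX DY hi hι₁, pureMk_eq_zero_iff] at hx
  obtain ⟨H', d, y, hd, hdy⟩ := hx
  obtain ⟨a₁, ha₁⟩ := dist_desc₂ hT' (e ≫ d) (by rw [← Category.assoc, he, hd])
  obtain ⟨a₂, rfl⟩ := DZ.isGEEnvelope _ H'.property.2 a₁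
  -- This extends `d` from the core of `X` to a morphism vanishing on the cover of `Y`. Subtracting
  -- its boundary makes the cycle zero on the first summand, so it comes from the core of `Z`.
  let d' : H.obj ⟶ H'.obj := biprod.desc d (-a₂)
  have hd' : DY.env ≫ d' = 0 := by
    simp [DY, d', biprod.lift_desc, ha₁]
  have hb : heartRes G d' y ∈ boundaries G DY := ⟨H', d', y, hd', rfl⟩
  have hz : x - heartRes G d' y ∈ cycles G DY := sub_mem hx' (boundaries_le_cycles G DY hb)
  have hz₁ : heartRes G ι₁ (x - heartRes G d' y) = 0 := by
    rw [map_sub, ← heartRes_comp, show ι₁ ≫ d' = d from biprod.inl_desc _ _, hdy, sub_self]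
  have hz₂ : heartRes G π₂ (heartRes G ι₂ (x - heartRes G d' y)) = x - heartRes G d' y := by
    conv_rhs => rw [← heartRes_id G H (x - heartRes G d' y),
      ← show biprod.fst ≫ ι₁ + π₂ ≫ ι₂ = 𝟙 H.obj from biprod.total, heartRes_add]
    rw [heartRes_comp, heartRes_comp, hz₁, map_zero, zero_add]
  -- A test map killed in `Z` lifts to the cover of `Y`; after subtracting a map through the cover
  -- of `X` it is killed in `Y`, where the cycle condition is known.
  have hz₃ : heartRes G ι₂ (x - heartRes G d' y) ∈ cycles G DZ := fun K k hk => by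
    obtain ⟨k', rfl⟩ := dist_lift₃ hT' k (DX.isLECover.eq_zero_shift K.property.1 _ (by
      rw [Category.assoc, hc, ← Category.assoc, hk, zero_comp]))
    obtain ⟨m, hm⟩ := dist_lift₂ hT (k' ≫ q) (by rw [Category.assoc, ← hπ, ← Category.assoc, hk])
    obtain ⟨m', rfl⟩ := DX.isLECover.lift K.property.1 m
    have hk' := hz K (k' - m' ≫ i) (by
      change _ ≫ q = 0
      rw [Preadditive.sub_comp, Category.assoc m', hi, ← hm, Category.assoc, sub_self])
    rw [← hz₂, ← heartRes_comp, Category.assoc, hπ₂, ← Category.assoc, Preadditive.sub_comp,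
      Category.assoc m', dist_comp₁₂ hT', comp_zero, sub_zero] at hk'
    exact hk'
  refine ⟨pureMk G DZ _ hz₃, ?_⟩
  rw [pureFunctor_map_mk G DY DZ hπ hπ₂, pureMk_eq_iff, hz₂, sub_sub_cancel_left]
  exact neg_mem hb

/-- A coproduct of objects of the heart which lies in the heart is a coproduct in the heart. -/
def isColimitHeartCofan {J : Type*} {X : J → w.heart.FullSubcategory}
    {c : Cofan fun j => (X j).obj} (hc : IsColimit c) (h : w.heart c.pt) :
    IsColimit (Cofan.mk (f := X) (⟨c.pt, h⟩ : w.heart.FullSubcategory)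
      fun j => ObjectProperty.homMk (c.inj j)) :=
  Cofan.IsColimit.mk _ (fun t => ObjectProperty.homMk (Cofan.IsColimit.desc hc fun j => (t.inj j).hom))
    (fun t j => ObjectProperty.hom_ext _
      (Cofan.IsColimit.fac hc (fun j => (t.inj j).hom) j))
    fun t _ hm => ObjectProperty.hom_ext _ (Cofan.IsColimit.hom_ext hc _ _ fun j =>
      (congrArg InducedCategory.Hom.hom (hm j)).trans
        (Cofan.IsColimit.fac hc (fun j => (t.inj j).hom) j).symm)

theorem bijective_heartRes {J : Type v} [PreservesLimitsOfShape (Discrete J) G]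
    {X : J → w.heart.FullSubcategory} {c : Cofan fun j => (X j).obj} (hc : IsColimit c)
    (h : w.heart c.pt) :
    Function.Bijective fun (x : G.obj (.op (⟨c.pt, h⟩ : w.heart.FullSubcategory))) (j : J) =>
      heartRes G (H' := ⟨c.pt, h⟩) (c.inj j) x :=
  bijective_of_preservesLimitsOfShape G (isColimitHeartCofan hc h)

theorem pureFunctor_coproduct [HasCoproducts.{v} C] (hw : w.IsSmashing) {J : Type v}
    [PreservesLimitsOfShape (Discrete J) G] {X : J → C} {c : Cofan X} (hc : IsColimit c) :
    ∃ (D : w.Resolution c.pt) (E : ∀ j, w.Resolution (X j)), Function.Bijective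
      fun (x : (pureFunctor G).obj D) (j : J) => (pureFunctor G).map (E j) D (c.inj j) x := by
  let E : ∀ j, w.Resolution (X j) := fun j => (w.nonempty_resolution (X j)).some
  have hP := coproductIsCoproduct fun j => (E j).obj
  have hH := coproductIsCoproduct fun j => (E j).core.obj
  let q : (∐ fun j => (E j).obj) ⟶ c.pt := Sigma.desc fun j => (E j).hom ≫ c.inj j
  have hq : ∀ j, Sigma.ι (fun j => (E j).obj) j ≫ q = (E j).hom ≫ c.inj j := fun j => by simp [q]
  have hHh := heart_of_isColimit_cofan hw hH fun j => (E j).core.property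
  let H : w.heart.FullSubcategory := ⟨∐ fun j => (E j).core.obj, hHh⟩
  let ι : ∀ j, (E j).core.obj ⟶ H.obj := Sigma.ι fun j => (E j).core.obj
  let D : w.Resolution c.pt :=
    { obj := _
      hom := q
      isLECover := .of_isColimit_cofan hw (fun j => (E j).isLECover) hP hc hq
      core := H
      env := Limits.Sigma.map fun j => (E j).env
      isGEEnvelope := fun V hV a => by
        choose b hb using fun j => (E j).isGEEnvelope V hV (Sigma.ι (fun j => (E j).obj) j ≫ a)
        exact ⟨Sigma.desc b, Sigma.hom_ext _ _ fun j => by simp [hb]⟩ }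
  have hι : ∀ j, (E j).env ≫ ι j = Sigma.ι (fun j => (E j).obj) j ≫ D.env := fun j => by
    simp [D, ι]
  have hbij : Function.Bijective fun (x : G.obj (.op H)) (j : J) => heartRes G (ι j) x :=
    bijective_heartRes G hH hHh
  have hmap : ∀ j x (hx : x ∈ cycles G D),
      (pureFunctor G).map (E j) D (c.inj j) (pureMk G D x hx) =
        pureMk G (E j) (heartRes G (ι j) x) (heartRes_mem_cycles G (hq j) (hι j) hx) :=
    fun j x hx => pureFunctor_map_mk G (E j) D (hq j) (hι j) hx
  refine ⟨D, E, fun x y hxy => ?_, fun s => ?_⟩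
  · obtain ⟨x, hx, rfl⟩ := exists_pureMk G D x
    obtain ⟨y, hy, rfl⟩ := exists_pureMk G D y
    rw [pureMk_eq_iff]
    have hxy' : ∀ j, heartRes G (ι j) (x - y) ∈ boundaries G (E j) := fun j => by
      have := congrFun hxy j
      simp only [hmap] at this
      rw [pureMk_eq_iff] at this
      rwa [map_sub]
    -- The boundaries on the components assemble over the coproduct of the `K j`, which stays in the
    -- heart because `w` is smashing.
    choose K d z hd hdz using hxy'
    have hK := coproductIsCoproduct fun j => (K j).obj
    have hKh := heart_of_isColimit_cofan hw hK fun j => (K j).property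
    let K' : w.heart.FullSubcategory := ⟨∐ fun j => (K j).obj, hKh⟩
    obtain ⟨z', hz'⟩ := (bijective_heartRes G hK hKh).2 z
    let d' : H.obj ⟶ K'.obj := Limits.Sigma.map d
    refine ⟨K', d', z', Sigma.hom_ext _ _ fun j => ?_, hbij.1 (funext fun j => ?_)⟩
    · simp only [D, d', Sigma.ι_map_assoc, Sigma.ι_map, comp_zero]
      rw [← Category.assoc, hd, zero_comp]
    · change heartRes G (ι j) (heartRes G d' z') = heartRes G (ι j) (x - y)
      have hz'' : heartRes G (H' := K') (Sigma.ι (fun j => (K j).obj) j) z' = z j :=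
        congrFun hz' j
      rw [← heartRes_comp, ← hdz, ← hz'', ← heartRes_comp]
      congr 1
      simp [ι, d']
  · choose x hx hxs using fun j => exists_pureMk G (E j) (s j)
    obtain ⟨y, hy⟩ := hbij.2 x
    replace hy : ∀ j, heartRes G (ι j) y = x j := fun j => congrFun hy j
    -- The fibre of the coproduct of covers is the coproduct of the fibres `S j`. A test map thus
    -- factors through the coproduct of the covers `T j`, objects of the heart on which `y` vanishes
    -- componentwise.
    have hyc : y ∈ cycles G D := fun K k hk => by
      choose S hS s' δ hT using fun j => (E j).isLECover.exists_kernel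
      choose T t ht using fun j => w.exists_isLECover (S j)
      have hTh : ∀ j, w.heart (T j) := fun j => (ht j).heart (hS j)
      obtain ⟨Δ, hΔ⟩ := exists_distinguished_of_isColimit_cofan hT (coproductIsCoproduct S) hP hc
        (U := Limits.Sigma.map s') (fun j => by simp) hq
      obtain ⟨k₁, rfl⟩ := dist_lift₂ hΔ k hk
      have hT' := coproductIsCoproduct T
      have hTh' := heart_of_isColimit_cofan hw hT' hTh
      obtain ⟨k₂, rfl⟩ := (IsLECover.of_isColimit_cofan hw ht hT' (coproductIsCoproduct S)
        (q := Limits.Sigma.map t) fun j => by simp).lift K.property.1 k₁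
      let T' : w.heart.FullSubcategory := ⟨∐ T, hTh'⟩
      let τ : T'.obj ⟶ H.obj := Limits.Sigma.map t ≫ Limits.Sigma.map s' ≫ D.env
      have hτ : heartRes G τ y = 0 :=
        (bijective_heartRes G (X := fun j => ⟨T j, hTh j⟩) hT' hTh').1 (funext fun j => by
          change heartRes G (H := ⟨T j, hTh j⟩) (H' := T') (Sigma.ι T j) (heartRes G τ y) =
            heartRes G (H := ⟨T j, hTh j⟩) (H' := T') (Sigma.ι T j) 0
          rw [map_zero, ← heartRes_comp, ← hx j ⟨T j, hTh j⟩ (t j ≫ s' j)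
            (by rw [Category.assoc, dist_comp₁₂ (hT j), comp_zero]), ← hy, ← heartRes_comp]
          congr 1
          simp [τ, D, ι])
      change K.obj ⟶ T'.obj at k₂
      have : ((k₂ ≫ Limits.Sigma.map t) ≫ Limits.Sigma.map s') ≫ D.env = k₂ ≫ τ := by
        simp [τ]
      refine (DFunLike.congr_fun (congrArg (heartRes G) this) y).trans ?_
      rw [heartRes_comp, hτ, map_zero]
    refine ⟨pureMk G D y hyc, funext fun j => (hmap j y hyc).trans ?_⟩
    rw [← hxs]
    congr 1
    exact hy j

end PureFunctor

end WeightStructure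

end TriangulatedAdjacent

namespace TriangulatedAdjacent

set_option linter.unusedSectionVars false

open Pretriangulated Triangulated ZeroObject

variable {C : Type u} [Category.{v} C] [Preadditive C] [HasZeroObject C] [HasShift C ℤ]
  [∀ n : ℤ, (shiftFunctor C n).Additive] [Pretriangulated C]

/-! ### Representing product-preserving functors on the heart of `w`. -/

namespace WeightStructure

variable {w : WeightStructure C}

/-- A product-preserving additive functor on the heart of a smashing weight structure is the
restriction of a representable functor vanishing on `C_{w ≤ -1}` and on `C_{w ≥ 1}`. -/
theorem exists_pure_representing [HasCoproducts.{v} C] (hC : BrownRepresentability C)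
    (hw : w.IsSmashing) (G : w.heart.FullSubcategoryᵒᵖ ⥤ AddCommGrpCat.{v}) [G.Additive]
    [∀ J : Type v, PreservesLimitsOfShape (Discrete J) G] :
    ∃ (Y : C) (_ : w.ge Y) (_ : ∀ R, w.gePos R → ∀ f : R ⟶ Y, f = 0),
      Nonempty (w.heart.ι.op ⋙ preadditiveYoneda.obj Y ≅ G) := by
  obtain ⟨Y, φ, hφ⟩ := (pureFunctor G).exists_representing hC w.nonempty_resolution
    (pureFunctor_map_zero G) (pureFunctor_exact G) (pureFunctor_coproduct G hw)
  let O : w.heart.FullSubcategory :=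
    ⟨0, le_of_isZero (isZero_zero C), ge_of_isZero (isZero_zero C)⟩
  -- A zero core forces the pure functor to vanish. Objects of `C_{w ≤ -1}` have such a resolution
  -- since their envelope is zero, those of `C_{w ≥ 1}` since their cover is zero.
  have hO : ∀ {N : C} (D : w.Resolution N) (_ : D.core = O) (f : N ⟶ Y), f = 0 := by
    rintro N ⟨P, p, hp, H, q, hq⟩ (rfl : H = O) f
    obtain ⟨y, rfl⟩ := (φ ⟨P, p, hp, O, q, hq⟩).surjective f
    obtain ⟨x, hx, rfl⟩ := exists_pureMk G _ y
    rw [map_eq_zero_iff _ (φ _).injective, pureMk_eq_zero_iff, ← heartRes_id G _ x,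
      show 𝟙 O.obj = 0 from (isZero_zero C).eq_of_src _ _, heartRes_zero]
    exact zero_mem _
  refine ⟨Y, ge_of_orthogonal fun L hL => ?_, fun R hR => ?_, ?_⟩
  · exact hO ⟨L, 𝟙 L, .id hL.le, O, 0, fun V hV a => ⟨0, by rw [leNeg_hom_ge hL hV a, zero_comp]⟩⟩
      rfl
  · exact hO ⟨0, 0, .of_lift (le_of_isZero (isZero_zero C))
      (fun X hX a => ⟨0, by rw [le_hom_gePos hX hR a, zero_comp]⟩)
      fun _ _ _ _ => (isZero_zero C).eq_of_tgt _ _, O, 0,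
      fun V hV a => ⟨0, (isZero_zero C).eq_of_src _ _⟩⟩ rfl
  -- For the identity resolution all sections are cycles and only zero is a boundary, so the pure
  -- functor restricts to `G`.
  · let D : ∀ H : w.heart.FullSubcategory, w.Resolution H.obj := fun H =>
      ⟨H.obj, 𝟙 _, .id H.property.1, H, 𝟙 _, fun V hV a => ⟨a, Category.id_comp a⟩⟩
    have hD : ∀ H (x : G.obj (.op H)), x ∈ cycles G (D H) := fun H x K k hk => by
      have hk₀ : k = 0 := by rw [← Category.comp_id k]; exact hk
      rw [hk₀, zero_comp]
      exact heartRes_zero G x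
    let ψ : ∀ H : w.heart.FullSubcategory, G.obj (.op H) →+ (H.obj ⟶ Y) := fun H =>
      AddMonoidHom.mk' (fun x => φ (D H) (pureMk G (D H) x (hD H x))) fun x y =>
        map_add (φ (D H)) (pureMk G (D H) x (hD H x)) (pureMk G (D H) y (hD H y))
    have hψ : ∀ H, Function.Bijective (ψ H) := fun H => by
      refine ⟨fun x y hxy => ?_, fun f => ?_⟩
      · obtain ⟨K, d, z, hd, hz⟩ := (pureMk_eq_iff G (D H) _ _).1 ((φ (D H)).injective hxy)
        have hd₀ : d = 0 := by rw [← Category.id_comp d]; exact hd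
        rw [hd₀, heartRes_zero] at hz
        exact sub_eq_zero.1 hz.symm
      · obtain ⟨y, rfl⟩ := (φ (D H)).surjective f
        obtain ⟨x, hx, rfl⟩ := exists_pureMk G (D H) y
        exact ⟨x, rfl⟩
    have hn : ∀ {H H' : w.heart.FullSubcategory} (d : H.obj ⟶ H'.obj) (x : G.obj (.op H')),
        ψ H (heartRes G d x) = d ≫ ψ H' x := fun {H H'} d x => by
      refine Eq.trans ?_ (hφ (D H) (D H') d (pureMk G (D H') x (hD H' x)))
      rw [pureFunctor_map_mk G (D H) (D H') (a := d) (b := d)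
        ((Category.comp_id d).trans (Category.id_comp d).symm)
        ((Category.id_comp d).trans (Category.comp_id d).symm)]
      rfl
    refine ⟨(NatIso.ofComponents (fun H => (AddEquiv.ofBijective (ψ H.unop)
      (hψ H.unop)).toAddCommGrpIso) fun {H H'} d => ?_).symm⟩
    ext x
    exact hn d.unop.hom x

theorem productPreservingAdditive_restrictedYoneda [HasCoproducts.{v} C] (hw : w.IsSmashing)
    (M : C) : productPreservingAdditive w.heart.FullSubcategory
      (w.heart.ι.op ⋙ preadditiveYoneda.obj M) := by
  refine ⟨⟨fun {H H' d d'} => ?_⟩, fun J => preservesLimitsOfShape_of_bijective _ J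
    fun X c hc => ?_⟩
  · ext x
    exact Preadditive.add_comp _ _ _ d.unop.hom d'.unop.hom x
  · have hH := coproductIsCoproduct fun j => (X j).obj
    have hH' := isColimitHeartCofan hH (heart_of_isColimit_cofan hw hH fun j => (X j).property)
    let e := hc.coconePointUniqueUpToIso hH'
    have he : ∀ j, (c.inj j).hom ≫ e.hom.hom = Sigma.ι (fun j => (X j).obj) j := fun j =>
      congrArg InducedCategory.Hom.hom (hc.comp_coconePointUniqueUpToIso_hom hH' ⟨j⟩)
    have he' : ∀ j, Sigma.ι (fun j => (X j).obj) j ≫ e.inv.hom = (c.inj j).hom := fun j =>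
      congrArg InducedCategory.Hom.hom (hc.comp_coconePointUniqueUpToIso_inv hH' ⟨j⟩)
    have hee : e.hom.hom ≫ e.inv.hom = 𝟙 c.pt.obj := congrArg InducedCategory.Hom.hom e.hom_inv_id
    refine ⟨fun (x : c.pt.obj ⟶ M) (y : c.pt.obj ⟶ M) hxy => ?_,
      fun (s : ∀ j, (X j).obj ⟶ M) => ⟨(e.hom.hom ≫ Sigma.desc s : c.pt.obj ⟶ M), funext fun j => ?_⟩⟩
    · rw [← Category.id_comp x, ← Category.id_comp y, ← hee, Category.assoc, Category.assoc]
      congr 1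
      refine Sigma.hom_ext _ _ fun j => ?_
      rw [← Category.assoc, ← Category.assoc, he']
      exact congrFun hxy j
    · change (c.inj j).hom ≫ e.hom.hom ≫ Sigma.desc s = s j
      rw [← Category.assoc, he, Sigma.ι_desc]

end WeightStructure

open WeightStructure

/-! ### The equivalence of the heart with product-preserving functors. -/

section Heart

variable [IsTriangulated C] [HasCoproducts.{v} C] {w : WeightStructure C} {t : TStructure C}

/-- The functor from the heart of `t` to product-preserving additive functors on the heart
of `w`, sending `M` to the restriction of the functor represented by `M`. -/
noncomputable def heartYoneda (t : TStructure C) (hw : w.IsSmashing) : t.heart.FullSubcategory ⥤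
    (productPreservingAdditive w.heart.FullSubcategory).FullSubcategory :=
  ObjectProperty.lift _ (t.heart.ι ⋙ preadditiveYoneda ⋙
    (Functor.whiskeringLeft _ _ _).obj w.heart.ι.op)
    fun M => productPreservingAdditive_restrictedYoneda hw M.obj

/-- A cover of `M` has its source in `Hw` and its cone in `C_{w ≥ 1}`; the cone has no maps to `N`,
so morphisms `M ⟶ N` are detected on the cover. -/
theorem heartYoneda_faithful (h : LeftAdjacent w t) (hw : w.IsSmashing) :
    (heartYoneda t hw).Faithful where
  map_injective {M N} f g hfg := by
    have hM := (heart_iff h M.obj).1 M.property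
    have hN := (heart_iff h N.obj).1 N.property
    obtain ⟨P, p, hp⟩ := w.exists_isLECover M.obj
    obtain ⟨R, hR, r, δ, hT⟩ := hp.exists_triangle
    have hpf : p ≫ f.hom = p ≫ g.hom := ConcreteCategory.congr_hom (NatTrans.congr_app
      (congrArg InducedCategory.Hom.hom hfg) (.op ⟨P, hp.heart hM.1⟩)) p
    obtain ⟨b, hb⟩ := dist_desc₂ hT (f.hom - g.hom) (by
      rw [Preadditive.comp_sub, hpf, sub_self])
    rw [hN.2 R hR b, comp_zero] at hb
    exact ObjectProperty.hom_ext _ (sub_eq_zero.1 hb.symm)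

/-- Present `M` by objects `T ⟶ P` of `Hw`, where `T` covers the fibre `S` of a cover `P ⟶ M`. The
image of the cover under `η` kills `T` by naturality, and hence `S`, since the cone of `T ⟶ S` has
no maps to `N`; so it descends to `M`. -/
theorem heartYoneda_full (h : LeftAdjacent w t) (hw : w.IsSmashing) :
    (heartYoneda t hw).Full where
  map_surjective {M N} η := by
    have hM := (heart_iff h M.obj).1 M.property
    have hN := (heart_iff h N.obj).1 N.property
    let e : ∀ H : w.heart.FullSubcategory, (H.obj ⟶ M.obj) →+ (H.obj ⟶ N.obj) := fun H =>
      (η.hom.app (.op H)).hom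
    have he : ∀ {H H' : w.heart.FullSubcategory} (d : H.obj ⟶ H'.obj) (x : H'.obj ⟶ M.obj),
        e H (d ≫ x) = d ≫ e H' x := fun {H H'} d x =>
      ConcreteCategory.congr_hom (η.hom.naturality (ObjectProperty.homMk (X := H) (Y := H') d).op) x
    obtain ⟨P, p, hp⟩ := w.exists_isLECover M.obj
    obtain ⟨S, hS, s, δ, hT⟩ := hp.exists_kernel
    obtain ⟨T, τ, hτ⟩ := w.exists_isLECover S
    obtain ⟨R, hR, r, δ', hT'⟩ := hτ.exists_triangle
    let P' : w.heart.FullSubcategory := ⟨P, hp.heart hM.1⟩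
    let T' : w.heart.FullSubcategory := ⟨T, hτ.heart hS⟩
    have hτs : (τ ≫ s) ≫ p = 0 := by rw [Category.assoc, dist_comp₁₂ hT, comp_zero]
    obtain ⟨b, hb⟩ := dist_desc₂ hT' (s ≫ e P' p) (by
      rw [← Category.assoc, ← he (H := T') (H' := P') (τ ≫ s) p, hτs]
      exact map_zero (e T'))
    obtain ⟨f, hf⟩ := dist_desc₂ hT (e P' p) (by rw [← hb, hN.2 R hR b, comp_zero])
    refine ⟨ObjectProperty.homMk f, ObjectProperty.hom_ext _ (NatTrans.ext (funext fun H => ?_))⟩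
    ext (x : H.unop.obj ⟶ M.obj)
    change x ≫ f = e H.unop x
    obtain ⟨y, rfl⟩ := hp.lift H.unop.property.1 x
    rw [Category.assoc, hf]
    exact (he (H' := P') y p).symm

theorem heartYoneda_essSurj (hC : BrownRepresentability C) (h : LeftAdjacent w t)
    (hw : w.IsSmashing) : (heartYoneda t hw).EssSurj where
  mem_essImage G := by
    have := G.property.1
    have := G.property.2
    obtain ⟨Y, hY, hY', ⟨e⟩⟩ := exists_pure_representing hC hw G.obj
    exact ⟨⟨Y, (heart_iff h Y).2 ⟨hY, hY'⟩⟩, ⟨ObjectProperty.isoMk _ e⟩⟩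

theorem nonempty_heart_equivalence (hC : BrownRepresentability C) (h : LeftAdjacent w t) :
    Nonempty (t.heart.FullSubcategory ≌
      (productPreservingAdditive w.heart.FullSubcategory).FullSubcategory) := by
  have hw := isSmashing_of_leftAdjacent h
  have := heartYoneda_faithful h hw
  have := heartYoneda_full h hw
  have := heartYoneda_essSurj hC h hw
  have : (heartYoneda t hw).IsEquivalence := {}
  exact ⟨(heartYoneda t hw).asEquivalence⟩

end Heart

end TriangulatedAdjacent

theorem mainTheorem1 (C : Type u) [Category.{v} C] [Preadditive C] [HasZeroObject C]
    [HasShift C ℤ] [∀ n : ℤ, (shiftFunctor C n).Additive] [Pretriangulated C]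
    [IsTriangulated C] [HasCoproducts.{v} C]
    (hC : TriangulatedAdjacent.BrownRepresentability C)
    (w : TriangulatedAdjacent.WeightStructure C) :
    ((∃ t : Triangulated.TStructure C, TriangulatedAdjacent.LeftAdjacent w t) ↔ w.IsSmashing) ∧
    ∀ t : Triangulated.TStructure C, TriangulatedAdjacent.LeftAdjacent w t →
      TriangulatedAdjacent.tGE t 0 = w.ge ∧
      TriangulatedAdjacent.TIsCosmashing t ∧
      Nonempty (t.heart.FullSubcategory ≌
        (TriangulatedAdjacent.productPreservingAdditive
          w.heart.FullSubcategory).FullSubcategory) :=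
  ⟨TriangulatedAdjacent.exists_leftAdjacent_iff hC, fun _ h =>
    ⟨TriangulatedAdjacent.tGE_zero_eq h, TriangulatedAdjacent.tIsCosmashing_of_leftAdjacent hC h,
      TriangulatedAdjacent.nonempty_heart_equivalence hC h⟩⟩
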